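/- All matroids are finite. Let $S$ be a finite set, let $r,r_1,\dots,r_q$ ($q\ge 0$) be nonnegative integers with $|S|\ge r$, and let $H_1,\dots,H_q\subseteq S$ satisfy $|H_i\cap H_j|\le r_i+r_j-r$ for all distinct $i,j$ and $|S\setminus H_i|+r_i\ge r$ for all $i$. The matroid on $S$ whose bases are the sets $X\subseteq S$ with $|X|=r$ and $|X\cap H_i|\le r_i$ for all $i$ is called an elementary split matroid. A split matroid is a direct sum of one elementary split matroid and finitely many (possibly zero) uniform matroids. Theorem. Let $M$ be a split matroid of rank $r$ on a ground set $S$ with $|S|=n$, and let $S=B_1\cup\dots\cup B_k$ be a partition of $S$ into $k$ pairwise disjoint bases of $M$. Then there is an ordering $s_1,\dots,s_n$ of $S$ such that (a) $\{s_i,s_{i+1},\dots,s_{i+r-1}\}$ is a basis of $M$ for every $i\in\{1,\dots,n\}$, where indices are taken cyclically modulo $n$; and (b) $B_i=\{s_{(i-1)r+1},\dots,s_{ir}\}$ for every $i\in\{1,\dots,k\}$; that is, each $B_i$ is an interval, and these intervals follow each other in the order $B_1,\dots,B_k$. Moreover, there are an algorithm and a polynomial $p$ such that, for every such $M$ and every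 such partition, the algorithm, given $B_1,\dots,B_k$ and access to an independence oracle for $M$ (which tells whether a given set is independent in $M$), makes at most $p(n)$ oracle calls and outputs an ordering with the properties (a) and (b). -/

import Mathlib

open scoped Function

namespace SplitMatroid

variable {α : Type*}

/-- The rank of a finite matroid as a natural number. -/
noncomputable def rk (M : Matroid α) : ℕ := M.eRank.toNat

/-- Elementary split matroids: for some nonnegative integers `r, ρ₁, …, ρ_q` and subsets
`H₁, …, H_q` of the (finite) ground set with `|H_i ∩ H_j| ≤ ρ_i + ρ_j - r` for `i ≠ j` and
`|E - H_i| + ρ_i ≥ r`, the bases are the `r`-subsets of `E` that meet each `H_i` in at most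
`ρ_i` elements. -/
def IsElementarySplit (M : Matroid α) : Prop :=
  M.E.Finite ∧ ∃ (r q : ℕ) (H : Fin q → Set α) (ρ : Fin q → ℕ),
    r ≤ M.E.ncard ∧
    (∀ i, H i ⊆ M.E) ∧
    (∀ i j, i ≠ j → (H i ∩ H j).ncard + r ≤ ρ i + ρ j) ∧
    (∀ i, r ≤ (M.E \ H i).ncard + ρ i) ∧
    ∀ X : Set α, M.IsBase X ↔ X ⊆ M.E ∧ X.ncard = r ∧ ∀ i, (X ∩ H i).ncard ≤ ρ i

/-- Uniform matroids on a finite ground set. -/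
def IsUniform (M : Matroid α) : Prop :=
  M.E.Finite ∧ ∃ r : ℕ, ∀ X : Set α, M.IsBase X ↔ X ⊆ M.E ∧ X.ncard = r

/-- Split matroids: the direct sum of one elementary split matroid and finitely many
(maybe zero) uniform matroids. -/
def IsSplit (M : Matroid α) : Prop :=
  ∃ (t : ℕ) (N : Fin (t + 1) → Matroid α) (h : Pairwise (Disjoint on fun i ↦ (N i).E)),
    IsElementarySplit (N 0) ∧ (∀ i : Fin t, IsUniform (N i.succ)) ∧ M = Matroid.disjointSigma N h

/-- `B 0, …, B (k - 1)` are pairwise disjoint bases whose union is the ground set. -/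
def IsBasePartition (M : Matroid α) {k : ℕ} (B : Fin k → Set α) : Prop :=
  (∀ i, M.IsBase (B i)) ∧ Pairwise (Disjoint on B) ∧ ⋃ i, B i = M.E

/-- The list `s` enumerates the ground set without repetition, and for every position `i` the
`rk M` elements that follow each other cyclically from position `i` on form a basis. -/
def IsCyclicOrdering (M : Matroid α) (s : List α) : Prop :=
  s.Nodup ∧ {x | x ∈ s} = M.E ∧
    ∀ i < s.length, M.IsBase {x | x ∈ (s.rotate i).take (rk M)}

/-- With `r = rk M` and positions counted from `0`, the set `B i` occupies exactly the positions
`i * r, …, (i + 1) * r - 1` of `s`: each `B i` is an interval, and these intervals follow each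
other in the order `B 0, B 1, …`. -/
def BlocksInOrder (M : Matroid α) {k : ℕ} (B : Fin k → Set α) (s : List α) : Prop :=
  ∀ i : Fin k, {x | x ∈ (s.drop (i * rk M)).take (rk M)} = B i

/-- A deterministic oracle procedure. Given the input (a list of bases, each a list of elements)
and the list of the oracle's answers so far, it either asks the oracle about a set
(`Sum.inl X`, the set of the members of `X`) or halts with an output (`Sum.inr s`). -/
abbrev OracleProcedure : Type := List (List ℕ) → List Bool → List ℕ ⊕ List ℕ

/-- `Reaches P M bs a`: on the input `bs`, with the independence oracle of `M`, the procedure `P`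
gets to the point where it has made `a.length` oracle calls, with the answers `a`. -/
inductive Reaches (P : OracleProcedure) (M : Matroid ℕ) (bs : List (List ℕ)) : List Bool → Prop
  | start : Reaches P M bs []
  | call {a : List Bool} {X : List ℕ} {b : Bool} (ha : Reaches P M bs a)
      (hX : P bs a = Sum.inl X) (hb : b = true ↔ M.Indep {x | x ∈ X}) : Reaches P M bs (a ++ [b])

/-- On the input `bs`, with the independence oracle of `M`, the procedure `P` halts with output `s`
after exactly `c` oracle calls. -/
def HaltsWith (P : OracleProcedure) (M : Matroid ℕ) (bs : List (List ℕ)) (s : List ℕ) (c : ℕ) :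
    Prop :=
  ∃ a : List Bool, Reaches P M bs a ∧ P bs a = Sum.inr s ∧ a.length = c

end SplitMatroid

/-!
The ordering is built in parallel in all blocks: in each stage every block `B m` gets one more
element at the end of its prefix, and the windows, which consist of the rest of a block and the
prefix of the following one, have to remain bases. A window loses the element `e m` and gains
`e (m + 1)`, so a stage amounts to a choice of `e` for which all these exchanges lead to bases. As
the bounds `ρ_i + ρ_j - r` on the intersections make two tight constraints of a window nearly
exclude each other, the pairs that cannot be exchanged have a simple structure, and a suitable
choice fails to exist only if, in one summand, two tight constraints split each window into two
rectangles of forbidden exchanges. This situation is avoided one stage ahead by changing a single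
element of the choice. Hence one choice and its variations in a single block are all the candidates
that an algorithm has to keep, and polynomially many independence queries suffice to find them.
-/

namespace SplitMatroid

open Finset

/-! ### Exchanges in elementary split summands -/

section Exchange

variable {α : Type*} [DecidableEq α] {W : Finset α} {x y z : α}

/-- The set `W` with its member `x` exchanged for `y`. -/
def exchange (W : Finset α) (x y : α) : Finset α := insert y (W.erase x)

lemma mem_exchange : z ∈ exchange W x y ↔ z = y ∨ (z ≠ x ∧ z ∈ W) := by
  simp [exchange]

lemma mem_exchange_self : y ∈ exchange W x y := mem_insert_self _ _

lemma mem_exchange_of_ne (hz : z ∈ W) (h : z ≠ x) : z ∈ exchange W x y :=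
  mem_exchange.2 (.inr ⟨h, hz⟩)

lemma card_exchange_inter (hx : x ∈ W) (hy : y ∉ W) (H : Finset α) :
    #(exchange W x y ∩ H) + (if x ∈ H then 1 else 0) = #(W ∩ H) + if y ∈ H then 1 else 0 := by
  have herase : #((W ∩ H).erase x) + (if x ∈ H then 1 else 0) = #(W ∩ H) := by
    split_ifs with h
    · exact card_erase_add_one (mem_inter.2 ⟨hx, h⟩)
    · rw [erase_eq_of_notMem (by simp [h]), add_zero]
  rw [← herase, add_right_comm, exchange]
  congr 1
  split_ifs with h
  · rw [insert_inter_of_mem h, erase_inter, card_insert_of_notMem (by simp [hy])]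
  · rw [insert_inter_of_notMem h, erase_inter, add_zero]

/-- The exchange of `x` for `y` turns `W` into a base of `M`. -/
def Exchanges (M : Matroid α) (W : Finset α) (x y : α) : Prop :=
  M.IsBase (exchange W x y : Set α)

lemma exists_exchanges {M : Matroid α} {X : Finset α} (hW : M.IsBase (W : Set α))
    (hX : M.IsBase (X : Set α)) (hx : x ∈ W) (hx' : x ∉ X) :
    ∃ y ∈ X, y ∉ W ∧ Exchanges M W x y := by
  obtain ⟨y, ⟨hy, hyW⟩, h⟩ := hW.exchange hX ⟨hx, hx'⟩
  exact ⟨y, hy, hyW, by rwa [Exchanges, exchange, coe_insert, coe_erase]⟩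

lemma exists_exchanges_of_notMem {M : Matroid α} {Y : Finset α} (hW : M.IsBase (W : Set α))
    (hY : M.IsBase (Y : Set α)) (hy : y ∈ Y) (hy' : y ∉ W) : ∃ x ∈ W, Exchanges M W x y := by
  obtain ⟨X, hX, hyX, hXW⟩ :=
    (hY.indep.subset (Set.singleton_subset_iff.2 hy)).exists_isBase_subset_union_isBase hW
  rw [Set.singleton_subset_iff] at hyX
  obtain ⟨x, hx, hxX⟩ : ((W : Set α) \ X).Nonempty := by
    rw [Set.sdiff_nonempty]
    exact fun h ↦ hy' (mem_coe.1 ((hW.eq_of_subset_isBase hX h).symm ▸ hyX))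
  obtain ⟨z, ⟨hz, hzW⟩, h⟩ := hW.exchange hX ⟨hx, hxX⟩
  obtain rfl : z = y := (hXW hz).resolve_right hzW
  exact ⟨x, hx, by rwa [Exchanges, exchange, coe_insert, coe_erase]⟩

end Exchange

/-- A summand of `M` that is elementary split, as far as the bases of `M` and the exchanges in them
are concerned: at most `ρ j` elements of a base lie in `H j`, and an exchange inside of the summand
that respects these bounds leads to a base. -/
structure SplitSummand {α : Type*} [DecidableEq α] (M : Matroid α) where
  /-- the ground set of the summand -/
  ground : Finset α
  /-- the rank of the summand -/
  rank : ℕ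
  /-- the indices of the constraints -/
  Index : Type
  /-- the constrained sets -/
  H : Index → Finset α
  /-- the bounds on the constrained sets -/
  ρ : Index → ℕ
  ground_subset : (ground : Set α) ⊆ M.E
  H_subset : ∀ j, H j ⊆ ground
  card_inter_add_rank_le : ∀ a b, a ≠ b → #(H a ∩ H b) + rank ≤ ρ a + ρ b
  card_inter_ground : ∀ {W : Finset α}, M.IsBase (W : Set α) → #(W ∩ ground) = rank
  card_inter_H_le : ∀ {W : Finset α}, M.IsBase (W : Set α) → ∀ j, #(W ∩ H j) ≤ ρ j
  exchanges : ∀ {W : Finset α} {x y : α}, M.IsBase (W : Set α) → x ∈ W → y ∉ W → x ∈ ground →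
    y ∈ ground → (∀ j, #(exchange W x y ∩ H j) ≤ ρ j) → Exchanges M W x y

/-- The pairs that the relation `g` excludes are closed under completing rectangles. -/
def RectangleClosed {α : Type*} (g : α → α → Prop) (Q Q' : Finset α) : Prop :=
  ∀ x ∈ Q, ∀ x' ∈ Q, ∀ y ∈ Q', ∀ y' ∈ Q', ¬ g x y → ¬ g x y' → ¬ g x' y → ¬ g x' y'

/-- In terms of the exchanges `g` between `Q` and `Q'`: the pairs that `g` excludes form two
rectangles whose sides cover `Q` and `Q'`. -/
def SplitAt {α : Type*} (g : α → α → Prop) (Q Q' : Set α) : Prop :=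
  ∃ z₀ ∈ Q, ∃ z₁ ∈ Q, ∃ y₀ ∈ Q', ∃ y₁ ∈ Q', ¬ g z₀ y₀ ∧ ¬ g z₁ y₁ ∧ g z₀ y₁ ∧
    (∀ z ∈ Q, ¬ g z y₀ ∨ ¬ g z y₁) ∧ ∀ y ∈ Q', ¬ g z₀ y ∨ ¬ g z₁ y

lemma splitAt_congr {α : Type*} {g g' : α → α → Prop} {Q Q' : Set α}
    (h : ∀ x ∈ Q, ∀ y ∈ Q', (g x y ↔ g' x y)) : SplitAt g Q Q' ↔ SplitAt g' Q Q' := by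
  unfold SplitAt
  refine exists_congr fun z₀ ↦ and_congr_right fun hz₀ ↦ exists_congr fun z₁ ↦
    and_congr_right fun hz₁ ↦ exists_congr fun y₀ ↦ and_congr_right fun hy₀ ↦
    exists_congr fun y₁ ↦ and_congr_right fun hy₁ ↦ ?_
  have hQ : (∀ z ∈ Q, ¬ g z y₀ ∨ ¬ g z y₁) ↔ ∀ z ∈ Q, ¬ g' z y₀ ∨ ¬ g' z y₁ :=
    forall₂_congr fun z hz ↦ by rw [h z hz y₀ hy₀, h z hz y₁ hy₁]
  have hQ' : (∀ y ∈ Q', ¬ g z₀ y ∨ ¬ g z₁ y) ↔ ∀ y ∈ Q', ¬ g' z₀ y ∨ ¬ g' z₁ y :=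
    forall₂_congr fun y hy ↦ by rw [h z₀ hz₀ y hy, h z₁ hz₁ y hy]
  rw [h z₀ hz₀ y₀ hy₀, h z₁ hz₁ y₁ hy₁, h z₀ hz₀ y₁ hy₁, hQ, hQ']

namespace SplitSummand

variable {α : Type*} [DecidableEq α] {M : Matroid α} (C : SplitSummand M) {W W' : Finset α}
  {Q Q' : Finset α} {x y x' y' : α}

lemma mem_ground_iff_of_exchanges (hW : M.IsBase (W : Set α)) (h : Exchanges M W x y) (hx : x ∈ W)
    (hy : y ∉ W) : x ∈ C.ground ↔ y ∈ C.ground := by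
  have hcard := card_exchange_inter hx hy C.ground
  rw [C.card_inter_ground hW, C.card_inter_ground h] at hcard
  split_ifs at hcard <;> simp_all

/-- The constraint `j` holds with equality at `W`. -/
def Tight (W : Finset α) (j : C.Index) : Prop := #(W ∩ C.H j) = C.ρ j

/-- The exchange of `x` for `y` in `W` violates the constraint `j`. -/
def Blocks (W : Finset α) (x y : α) (j : C.Index) : Prop :=
  C.Tight W j ∧ x ∉ C.H j ∧ y ∈ C.H j

variable {C} {i j : C.Index}

lemma tight_congr (h : W ∩ C.ground = W' ∩ C.ground) : C.Tight W j ↔ C.Tight W' j := by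
  rw [Tight, Tight, ← inter_eq_right.2 (C.H_subset j), ← inter_assoc, ← inter_assoc, h]

lemma card_inter_H_add_le (hW : M.IsBase (W : Set α)) (hij : i ≠ j) :
    #(W ∩ C.H i) + #(W ∩ C.H j) + #((W ∩ C.ground) \ (C.H i ∪ C.H j)) +
      #((C.H i ∩ C.H j) \ W) ≤ C.ρ i + C.ρ j := by
  have hunion := card_union_add_card_inter (W ∩ C.H i) (W ∩ C.H j)
  have hground : #(W ∩ C.H i ∪ W ∩ C.H j) + #((W ∩ C.ground) \ (C.H i ∪ C.H j)) = C.rank := by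
    rw [← C.card_inter_ground hW, ← inter_union_distrib_left,
      ← card_inter_add_card_sdiff (W ∩ C.ground) (C.H i ∪ C.H j), inter_assoc,
      inter_eq_right.2 (union_subset (C.H_subset i) (C.H_subset j))]
  have hinter : #(W ∩ C.H i ∩ (W ∩ C.H j)) + #((C.H i ∩ C.H j) \ W) = #(C.H i ∩ C.H j) := by
    rw [← inter_inter_distrib_left, inter_comm W, card_inter_add_card_sdiff]
  have := C.card_inter_add_rank_le i j hij
  omega

lemma Tight.eq_of_notMem (hW : M.IsBase (W : Set α)) (hi : C.Tight W i) (hj : C.Tight W j)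
    (hx : x ∈ W) (hxC : x ∈ C.ground) (hxi : x ∉ C.H i) (hxj : x ∉ C.H j) : i = j := by
  by_contra hij
  have hle := card_inter_H_add_le hW hij
  have hpos : 0 < #((W ∩ C.ground) \ (C.H i ∪ C.H j)) := card_pos.2 ⟨x, by simp [*]⟩
  rw [hi, hj] at hle
  omega

lemma Tight.eq_of_mem (hW : M.IsBase (W : Set α)) (hi : C.Tight W i) (hj : C.Tight W j)
    (hy : y ∉ W) (hyi : y ∈ C.H i) (hyj : y ∈ C.H j) : i = j := by
  by_contra hij
  have hle := card_inter_H_add_le hW hij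
  have hpos : 0 < #((C.H i ∩ C.H j) \ W) := card_pos.2 ⟨y, by simp [*]⟩
  rw [hi, hj] at hle
  omega

lemma Tight.eq_of_card_add_one (hW : M.IsBase (W : Set α)) (hi : C.Tight W i)
    (hj : #(W ∩ C.H j) + 1 = C.ρ j) (hx : x ∈ W) (hxC : x ∈ C.ground) (hxi : x ∉ C.H i)
    (hxj : x ∉ C.H j) (hy : y ∉ W) (hyi : y ∈ C.H i) (hyj : y ∈ C.H j) : i = j := by
  by_contra hij
  have hle := card_inter_H_add_le hW hij
  have hx_pos : 0 < #((W ∩ C.ground) \ (C.H i ∪ C.H j)) := card_pos.2 ⟨x, by simp [*]⟩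
  have hy_pos : 0 < #((C.H i ∩ C.H j) \ W) := card_pos.2 ⟨y, by simp [*]⟩
  rw [hi] at hle
  omega

lemma exchanges_iff (hW : M.IsBase (W : Set α)) (hx : x ∈ W) (hy : y ∉ W)
    (hxC : x ∈ C.ground) (hyC : y ∈ C.ground) :
    Exchanges M W x y ↔ ∀ j, ¬ C.Blocks W x y j := by
  have hcard := fun j ↦ card_exchange_inter hx hy (C.H j)
  constructor
  · rintro h j ⟨hj, hxj, hyj⟩
    have hle := C.card_inter_H_le h j
    have := hcard j
    rw [if_neg hxj, if_pos hyj, hj] at this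
    omega
  · refine fun h ↦ C.exchanges hW hx hy hxC hyC fun j ↦ ?_
    have hle := C.card_inter_H_le hW j
    have hj : #(W ∩ C.H j) = C.ρ j → x ∉ C.H j → y ∉ C.H j := fun ht hxj hyj ↦ h j ⟨ht, hxj, hyj⟩
    have := hcard j
    split_ifs at this with hxj hyj hyj <;> grind

/-- `W` is a base that contains `Q` and avoids `Q'`, where `Q` and `Q'` lie in the summand. -/
structure Separates (C : SplitSummand M) (W Q Q' : Finset α) : Prop where
  isBase : M.IsBase (W : Set α)
  subset : Q ⊆ W
  notMem : ∀ y ∈ Q', y ∉ W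
  subset_ground : Q ⊆ C.ground
  subset_ground' : Q' ⊆ C.ground

lemma Separates.not_exchanges_iff (h : C.Separates W Q Q') (hx : x ∈ Q) (hy : y ∈ Q') :
    ¬ Exchanges M W x y ↔ ∃ j, C.Blocks W x y j := by
  simp [exchanges_iff h.isBase (h.subset hx) (h.notMem y hy) (h.subset_ground hx)
    (h.subset_ground' hy)]

lemma Separates.eq_of_blocks_left (h : C.Separates W Q Q') (hx : x ∈ Q) (hi : C.Blocks W x y i)
    (hj : C.Blocks W x y' j) : i = j :=
  hi.1.eq_of_notMem h.isBase hj.1 (h.subset hx) (h.subset_ground hx) hi.2.1 hj.2.1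

lemma Separates.eq_of_blocks_right (h : C.Separates W Q Q') (hy : y ∈ Q') (hi : C.Blocks W x y i)
    (hj : C.Blocks W x' y j) : i = j :=
  hi.1.eq_of_mem h.isBase hj.1 (h.notMem y hy) hi.2.2 hj.2.2

lemma Separates.rectangleClosed (h : C.Separates W Q Q') :
    RectangleClosed (Exchanges M W) Q Q' := by
  intro x hx x' hx' y hy y' hy' hxy hxy' hx'y
  rw [h.not_exchanges_iff ‹_› ‹_›] at *
  obtain ⟨i, hi⟩ := hxy
  obtain ⟨i', hi'⟩ := hxy'
  obtain ⟨i'', hi''⟩ := hx'y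
  obtain rfl := h.eq_of_blocks_left hx hi hi'
  obtain rfl := h.eq_of_blocks_right hy hi hi''
  exact ⟨i, hi.1, hi''.2.1, hi'.2.2⟩

/-- Two tight constraints `F` and `G` such that each element of `Q` avoids one of them, each
element of `Q'` lies in one of them, and all four cases occur. -/
structure DoublyTight (C : SplitSummand M) (W Q Q' : Finset α) (F G : C.Index) : Prop
    extends C.Separates W Q Q' where
  ne : F ≠ G
  tight_left : C.Tight W F
  tight_right : C.Tight W G
  notMem_or : ∀ z ∈ Q, z ∉ C.H F ∨ z ∉ C.H G
  mem_or : ∀ y ∈ Q', y ∈ C.H F ∨ y ∈ C.H G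
  exists_notMem_left : ∃ z ∈ Q, z ∉ C.H F
  exists_notMem_right : ∃ z ∈ Q, z ∉ C.H G
  exists_mem_left : ∃ y ∈ Q', y ∈ C.H F
  exists_mem_right : ∃ y ∈ Q', y ∈ C.H G

variable {F G : C.Index}

namespace DoublyTight

lemma symm (h : C.DoublyTight W Q Q' F G) : C.DoublyTight W Q Q' G F where
  toSeparates := h.toSeparates
  ne := h.ne.symm
  tight_left := h.tight_right
  tight_right := h.tight_left
  notMem_or z hz := (h.notMem_or z hz).symm
  mem_or y hy := (h.mem_or y hy).symm
  exists_notMem_left := h.exists_notMem_right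
  exists_notMem_right := h.exists_notMem_left
  exists_mem_left := h.exists_mem_right
  exists_mem_right := h.exists_mem_left

lemma mem_H_or (h : C.DoublyTight W Q Q' F G) (hx : x ∈ W) (hxC : x ∈ C.ground) :
    x ∈ C.H F ∨ x ∈ C.H G := by
  by_contra! hc
  exact h.ne (h.tight_left.eq_of_notMem h.isBase h.tight_right hx hxC hc.1 hc.2)

lemma mem_of_mem_H (h : C.DoublyTight W Q Q' F G) (hF : x ∈ C.H F) (hG : x ∈ C.H G) : x ∈ W := by
  by_contra hc
  exact h.ne (h.tight_left.eq_of_mem h.isBase h.tight_right hc hF hG)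

lemma congr (h : C.DoublyTight W Q Q' F G) (hs : C.Separates W' Q Q')
    (hW : W ∩ C.ground = W' ∩ C.ground) : C.DoublyTight W' Q Q' F G :=
  { h with
    toSeparates := hs
    tight_left := (tight_congr hW).1 h.tight_left
    tight_right := (tight_congr hW).1 h.tight_right }

lemma splitAt (h : C.DoublyTight W Q Q' F G) : SplitAt (Exchanges M W) Q Q' := by
  obtain ⟨z₀, hz₀, hz₀F⟩ := h.exists_notMem_left
  obtain ⟨z₁, hz₁, hz₁G⟩ := h.exists_notMem_right
  obtain ⟨y₀, hy₀, hy₀F⟩ := h.exists_mem_left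
  obtain ⟨y₁, hy₁, hy₁G⟩ := h.exists_mem_right
  have hF : ∀ z ∈ Q, z ∉ C.H F → ∀ y ∈ Q', y ∈ C.H F → ¬ Exchanges M W z y :=
    fun z hz hzF y hy hyF ↦ (h.not_exchanges_iff hz hy).2 ⟨F, h.tight_left, hzF, hyF⟩
  have hG : ∀ z ∈ Q, z ∉ C.H G → ∀ y ∈ Q', y ∈ C.H G → ¬ Exchanges M W z y :=
    fun z hz hzG y hy hyG ↦ (h.not_exchanges_iff hz hy).2 ⟨G, h.tight_right, hzG, hyG⟩
  refine ⟨z₀, hz₀, z₁, hz₁, y₀, hy₀, y₁, hy₁, hF z₀ hz₀ hz₀F y₀ hy₀ hy₀F,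
    hG z₁ hz₁ hz₁G y₁ hy₁ hy₁G, ?_, fun z hz ↦ ?_, fun y hy ↦ ?_⟩
  · by_contra hc
    obtain ⟨j, hj⟩ := (h.not_exchanges_iff hz₀ hy₁).1 hc
    obtain rfl := h.eq_of_blocks_left hz₀ ⟨h.tight_left, hz₀F, hy₀F⟩ hj
    exact h.notMem y₁ hy₁ (h.mem_of_mem_H hj.2.2 hy₁G)
  · exact (h.notMem_or z hz).imp (hF z hz · y₀ hy₀ hy₀F) (hG z hz · y₁ hy₁ hy₁G)
  · exact (h.mem_or y hy).imp (hF z₀ hz₀ hz₀F y hy) (hG z₁ hz₁ hz₁G y hy)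

end DoublyTight

lemma Separates.exists_doublyTight (h : C.Separates W Q Q') (hs : SplitAt (Exchanges M W) Q Q') :
    ∃ F G, C.DoublyTight W Q Q' F G := by
  obtain ⟨z₀, hz₀, z₁, hz₁, y₀, hy₀, y₁, hy₁, h00, h11, h01, hz, hy⟩ := hs
  obtain ⟨F, hF⟩ := (h.not_exchanges_iff hz₀ hy₀).1 h00
  obtain ⟨G, hG⟩ := (h.not_exchanges_iff hz₁ hy₁).1 h11
  refine ⟨F, G, h, ?_, hF.1, hG.1, fun z hzQ ↦ ?_, fun y hyQ ↦ ?_, ⟨z₀, hz₀, hF.2.1⟩,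
    ⟨z₁, hz₁, hG.2.1⟩, ⟨y₀, hy₀, hF.2.2⟩, ⟨y₁, hy₁, hG.2.2⟩⟩
  · rintro rfl
    exact (h.not_exchanges_iff hz₀ hy₁).2 ⟨F, hF.1, hF.2.1, hG.2.2⟩ h01
  · rcases hz z hzQ with hzy | hzy
    · obtain ⟨j, hj⟩ := (h.not_exchanges_iff hzQ hy₀).1 hzy
      obtain rfl := h.eq_of_blocks_right hy₀ hF hj
      exact .inl hj.2.1
    · obtain ⟨j, hj⟩ := (h.not_exchanges_iff hzQ hy₁).1 hzy
      obtain rfl := h.eq_of_blocks_right hy₁ hG hj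
      exact .inr hj.2.1
  · rcases hy y hyQ with hzy | hzy
    · obtain ⟨j, hj⟩ := (h.not_exchanges_iff hz₀ hyQ).1 hzy
      obtain rfl := h.eq_of_blocks_left hz₀ hF hj
      exact .inl hj.2.2
    · obtain ⟨j, hj⟩ := (h.not_exchanges_iff hz₁ hyQ).1 hzy
      obtain rfl := h.eq_of_blocks_left hz₁ hG hj
      exact .inr hj.2.2

lemma Separates.splitAt_iff (h : C.Separates W Q Q') :
    SplitAt (Exchanges M W) Q Q' ↔ ∃ F G, C.DoublyTight W Q Q' F G :=
  ⟨h.exists_doublyTight, fun ⟨_, _, hFG⟩ ↦ hFG.splitAt⟩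

namespace DoublyTight

variable {d f : α}

lemma of_exchange (h : C.DoublyTight (exchange W x y) (Q.erase x) (Q'.erase y) F G)
    (hs : C.Separates W Q Q') (hx : x ∈ Q) (hy : y ∈ Q') (hxFG : x ∈ C.H F ∨ x ∈ C.H G)
    (hyFG : y ∉ C.H F ∨ y ∉ C.H G) : C.DoublyTight W Q Q' F G := by
  have hcard := fun j ↦ card_exchange_inter (hs.subset hx) (hs.notMem y hy) (C.H j)
  have hmem : ∀ j, C.Tight (exchange W x y) j → x ∈ C.H j → y ∈ C.H j := by
    intro j hj hxj
    by_contra hyj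
    have hcard := hcard j
    have hle := C.card_inter_H_le hs.isBase j
    rw [hj, if_pos hxj, if_neg hyj] at hcard
    omega
  have hyFG' := h.mem_H_or mem_exchange_self (hs.subset_ground' hy)
  have hxyF : x ∈ C.H F ↔ y ∈ C.H F := by
    have := hmem F h.tight_left; have := hmem G h.tight_right; tauto
  have hxyG : x ∈ C.H G ↔ y ∈ C.H G := by
    have := hmem F h.tight_left; have := hmem G h.tight_right; tauto
  have htight : ∀ j, (x ∈ C.H j ↔ y ∈ C.H j) → C.Tight (exchange W x y) j → C.Tight W j := by
    intro j hj ht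
    have hcard := hcard j
    rw [if_congr hj rfl rfl, ht] at hcard
    exact (Nat.add_right_cancel hcard).symm
  refine ⟨hs, h.ne, htight F hxyF h.tight_left, htight G hxyG h.tight_right,
    fun z hz ↦ ?_, fun z hz ↦ ?_, ?_, ?_, ?_, ?_⟩
  · by_cases hzx : z = x
    · subst hzx; tauto
    · exact h.notMem_or z (mem_erase.2 ⟨hzx, hz⟩)
  · by_cases hzy : z = y
    · exact hzy ▸ hyFG'
    · exact h.mem_or z (mem_erase.2 ⟨hzy, hz⟩)
  · exact h.exists_notMem_left.imp fun _ ↦ .imp_left mem_of_mem_erase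
  · exact h.exists_notMem_right.imp fun _ ↦ .imp_left mem_of_mem_erase
  · exact h.exists_mem_left.imp fun _ ↦ .imp_left mem_of_mem_erase
  · exact h.exists_mem_right.imp fun _ ↦ .imp_left mem_of_mem_erase

lemma not_doublyTight_exchange_right (h : C.DoublyTight W Q Q' F G) (hdW : d ∉ W) (hf : f ∈ Q)
    (hdF : d ∉ C.H F) (hdG : d ∉ C.H G) (hfF : f ∉ C.H F) {F' G' : C.Index} :
    ¬ C.DoublyTight (exchange W f d) (exchange Q f d) Q' F' G' := by
  intro h'
  have hfW := h.subset hf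
  have hfG := (h.mem_H_or hfW (h.subset_ground hf)).resolve_left hfF
  have htightF : C.Tight (exchange W f d) F := by
    have hcard := card_exchange_inter hfW hdW (C.H F)
    rwa [if_neg hfF, if_neg hdF, h.tight_left] at hcard
  have hcardG : #(exchange W f d ∩ C.H G) + 1 = C.ρ G := by
    have hcard := card_exchange_inter hfW hdW (C.H G)
    rwa [if_pos hfG, if_neg hdG, h.tight_right] at hcard
  wlog hF : d ∉ C.H F' generalizing F' G'
  · exact this h'.symm ((h'.notMem_or d mem_exchange_self).resolve_left hF)
  obtain rfl : F = F' := htightF.eq_of_notMem h'.isBase h'.tight_left mem_exchange_self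
    (h'.subset_ground mem_exchange_self) hdF hF
  obtain ⟨y, hy, hyG⟩ := h.exists_mem_right
  have hyF : y ∉ C.H F := fun hyF ↦ h.notMem y hy (h.mem_of_mem_H hyF hyG)
  have hyG' := (h'.mem_or y hy).resolve_left hyF
  obtain ⟨z, hz, hzG⟩ := h.exists_notMem_right
  have hzf : z ≠ f := by rintro rfl; exact hzG hfG
  have hzF := (h.mem_H_or (h.subset hz) (h.subset_ground hz)).resolve_right hzG
  have hzG' := (h'.notMem_or z (mem_exchange_of_ne hz hzf)).resolve_left (not_not.2 hzF)
  obtain rfl := h'.tight_right.eq_of_card_add_one h'.isBase hcardG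
    (mem_exchange_of_ne (h.subset hz) hzf) (h.subset_ground hz) hzG' hzG (h'.notMem y hy) hyG' hyG
  exact absurd (hcardG.trans h'.tight_right.symm) (Nat.succ_ne_self _)

lemma not_doublyTight_exchange_left (h : C.DoublyTight W Q Q' F G) (hdW : d ∈ W) (hf : f ∈ Q')
    (hdF : d ∈ C.H F) (hdG : d ∈ C.H G) (hfF : f ∉ C.H F) {F' G' : C.Index} :
    ¬ C.DoublyTight (exchange W d f) Q (exchange Q' f d) F' G' := by
  intro h'
  have hfW := h.notMem f hf
  have hfG := (h.mem_or f hf).resolve_left hfF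
  have hcardF : #(exchange W d f ∩ C.H F) + 1 = C.ρ F := by
    have hcard := card_exchange_inter hdW hfW (C.H F)
    rwa [if_pos hdF, if_neg hfF, h.tight_left] at hcard
  have htightG : C.Tight (exchange W d f) G := by
    have hcard := card_exchange_inter hdW hfW (C.H G)
    rw [if_pos hdG, if_pos hfG, h.tight_right] at hcard
    exact Nat.add_right_cancel hcard
  obtain ⟨z, hz, hzG⟩ := h.exists_notMem_right
  wlog hG : z ∉ C.H G' generalizing F' G'
  · exact this h'.symm ((h'.notMem_or z hz).resolve_right hG)
  obtain rfl : G = G' := htightG.eq_of_notMem h'.isBase h'.tight_right (h'.subset hz)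
    (h.subset_ground hz) hzG hG
  obtain ⟨y, hy, hyF⟩ := h.exists_mem_left
  have hyG : y ∉ C.H G := fun hyG ↦ h.notMem y hy (h.mem_of_mem_H hyF hyG)
  have hyf : y ≠ f := by rintro rfl; exact hfF hyF
  have hy' := mem_exchange_of_ne (y := d) hy hyf
  have hyF' := (h'.mem_or y hy').resolve_right hyG
  obtain ⟨z₀, hz₀, hz₀F⟩ := h.exists_notMem_left
  have hz₀G := (h.mem_H_or (h.subset hz₀) (h.subset_ground hz₀)).resolve_left hz₀F
  have hz₀F' := (h'.notMem_or z₀ hz₀).resolve_right (not_not.2 hz₀G)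
  obtain rfl := h'.tight_left.eq_of_card_add_one h'.isBase hcardF (h'.subset hz₀)
    (h.subset_ground hz₀) hz₀F' hz₀F (h'.notMem y hy') hyF' hyF
  exact absurd (hcardF.trans h'.tight_left.symm) (Nat.succ_ne_self _)

variable {Wl Wr Ql Qr : Finset α} {Fl Gl Fr Gr : C.Index}

lemma exists_exchange_of_notMem (hl : C.DoublyTight Wl Ql Q Fl Gl)
    (hr : C.DoublyTight Wr Q Qr Fr Gr) (hdC : d ∈ C.ground) (hdl : d ∈ Wl) (hdr : d ∉ Wr)
    (hdF : d ∉ C.H Fr) (hdG : d ∉ C.H Gr) :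
    ∃ f ∈ Q, Exchanges M Wl d f ∧ Exchanges M Wr f d ∧
      ∀ F G, ¬ C.DoublyTight (exchange Wr f d) (exchange Q f d) Qr F G := by
  wlog hdFl : d ∈ C.H Fl generalizing Fl Gl
  · exact this hl.symm ((hl.mem_H_or hdl hdC).resolve_left hdFl)
  obtain ⟨f, hf, hfFl⟩ := hl.exists_mem_left
  have hfl := hl.notMem f hf
  have hfC := hl.subset_ground' hf
  wlog hfFr : f ∉ C.H Fr generalizing Fr Gr
  · exact this hr.symm hdG hdF ((hr.notMem_or f hf).resolve_left hfFr)
  refine ⟨f, hf, ?_, ?_, fun F G ↦ hr.not_doublyTight_exchange_right hdr hf hdF hdG hfFr⟩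
  · rw [exchanges_iff hl.isBase hdl hfl hdC hfC]
    rintro j ⟨hj, hdj, hfj⟩
    obtain rfl := hl.tight_left.eq_of_mem hl.isBase hj hfl hfFl hfj
    exact hdj hdFl
  · rw [exchanges_iff hr.isBase (hr.subset hf) hdr hfC hdC]
    rintro j ⟨hj, hfj, hdj⟩
    obtain rfl := hr.tight_left.eq_of_notMem hr.isBase hj (hr.subset hf) hfC hfFr hfj
    exact hdF hdj

lemma exists_exchange_of_mem (hl : C.DoublyTight Wl Ql Q Fl Gl)
    (hr : C.DoublyTight Wr Q Qr Fr Gr) (hdC : d ∈ C.ground) (hdl : d ∈ Wl) (hdr : d ∉ Wr)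
    (hdF : d ∈ C.H Fl) (hdG : d ∈ C.H Gl) :
    ∃ f ∈ Q, Exchanges M Wl d f ∧ Exchanges M Wr f d ∧
      ∀ F G, ¬ C.DoublyTight (exchange Wl d f) Ql (exchange Q f d) F G := by
  wlog hdGr : d ∉ C.H Gr generalizing Fr Gr
  · exact this hr.symm fun hdFr ↦ hdr (hr.mem_of_mem_H hdFr (not_not.1 hdGr))
  obtain ⟨f, hf, hfGr⟩ := hr.exists_notMem_right
  have hfl := hl.notMem f hf
  have hfC := hl.subset_ground' hf
  wlog hfFl : f ∉ C.H Fl generalizing Fl Gl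
  · exact this hl.symm hdG hdF fun hfGl ↦ hfl (hl.mem_of_mem_H (not_not.1 hfFl) hfGl)
  refine ⟨f, hf, ?_, ?_, fun F G ↦ hl.not_doublyTight_exchange_left hdl hf hdF hdG hfFl⟩
  · rw [exchanges_iff hl.isBase hdl hfl hdC hfC]
    rintro j ⟨hj, hdj, hfj⟩
    have hfGl := (hl.mem_or f hf).resolve_left hfFl
    obtain rfl := hl.tight_right.eq_of_mem hl.isBase hj hfl hfGl hfj
    exact hdj hdG
  · rw [exchanges_iff hr.isBase (hr.subset hf) hdr hfC hdC]
    rintro j ⟨hj, hfj, hdj⟩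
    obtain rfl := hr.tight_right.eq_of_notMem hr.isBase hj (hr.subset hf) hfC hfGr hfj
    exact hdGr hdj

lemma exists_exchange (hl : C.DoublyTight Wl Ql Q Fl Gl) (hr : C.DoublyTight Wr Q Qr Fr Gr)
    (hdC : d ∈ C.ground) (hdl : d ∈ Wl) (hdr : d ∉ Wr)
    (hd : (d ∉ C.H Fr ∧ d ∉ C.H Gr) ∨ (d ∈ C.H Fl ∧ d ∈ C.H Gl)) :
    ∃ f ∈ Q, Exchanges M Wl d f ∧ Exchanges M Wr f d ∧
      ((∀ F G, ¬ C.DoublyTight (exchange Wl d f) Ql (exchange Q f d) F G) ∨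
        ∀ F G, ¬ C.DoublyTight (exchange Wr f d) (exchange Q f d) Qr F G) := by
  rcases hd with hd | hd
  · obtain ⟨f, hf, hfl, hfr, hno⟩ := hl.exists_exchange_of_notMem hr hdC hdl hdr hd.1 hd.2
    exact ⟨f, hf, hfl, hfr, .inr hno⟩
  · obtain ⟨f, hf, hfl, hfr, hno⟩ := hl.exists_exchange_of_mem hr hdC hdl hdr hd.1 hd.2
    exact ⟨f, hf, hfl, hfr, .inl hno⟩

end DoublyTight

end SplitSummand

section ClosedWalk

variable {α : Type*} {n : ℕ}

/-- Walks of `l + 1` steps along `g` from level `m` to level `m + l + 1` whose intermediate points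
lie in the sets `Q`. -/
def Reach (Q : ZMod (n + 2) → Finset α) (g : ZMod (n + 2) → α → α → Prop) (m : ZMod (n + 2)) :
    ℕ → α → α → Prop
  | 0, x, z => g m x z
  | l + 1, x, z => ∃ y ∈ Q (m + l + 1), Reach Q g m l x y ∧ g (m + l + 1) y z

variable {Q : ZMod (n + 2) → Finset α} {g : ZMod (n + 2) → α → α → Prop} {m : ZMod (n + 2)}

lemma exists_reach (hstep : ∀ m, ∀ x ∈ Q m, ∃ y ∈ Q (m + 1), g m x y) (l : ℕ) :
    ∀ x ∈ Q m, ∃ z ∈ Q (m + l + 1), Reach Q g m l x z := by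
  induction l with
  | zero => simpa [Reach] using hstep m
  | succ l ih =>
    intro x hx
    obtain ⟨y, hy, hxy⟩ := ih x hx
    obtain ⟨z, hz, hyz⟩ := hstep _ y hy
    exact ⟨z, by simpa [add_assoc] using hz, y, hy, hxy, hyz⟩

lemma rectangleClosed_reach (hstep : ∀ m, ∀ x ∈ Q m, ∃ y ∈ Q (m + 1), g m x y)
    (hrect : ∀ m, RectangleClosed (g m) (Q m) (Q (m + 1))) (l : ℕ) :
    RectangleClosed (Reach Q g m l) (Q m) (Q (m + l + 1)) := by
  cases l with
  | zero => simpa [Reach] using hrect m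
  | succ l =>
    rintro x hx x' - z hz z' hz' hxz hxz' hx'z ⟨y, hy, hx'y, hyz'⟩
    obtain ⟨u, hu, hxu⟩ := exists_reach hstep l x hx
    rw [Nat.cast_succ, ← add_assoc m] at hz hz'
    exact hrect _ u hu y hy z hz z' hz' (fun h ↦ hxz ⟨u, hu, hxu, h⟩)
      (fun h ↦ hxz' ⟨u, hu, hxu, h⟩) (fun h ↦ hx'z ⟨y, hy, hx'y, h⟩) hyz'

lemma Reach.exists_walk {l : ℕ} : ∀ {x z : α}, x ∈ Q m → z ∈ Q (m + l + 1) → Reach Q g m l x z →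
    ∃ p : ℕ → α, p 0 = x ∧ p (l + 1) = z ∧ (∀ i ≤ l + 1, p i ∈ Q (m + i)) ∧
      ∀ i ≤ l, g (m + i) (p i) (p (i + 1)) := by
  induction l with
  | zero =>
    intro x z hx hz h
    refine ⟨fun i ↦ if i = 0 then x else z, rfl, rfl, fun i hi ↦ ?_, fun i hi ↦ ?_⟩
    · interval_cases i
      · simpa using hx
      · simpa using hz
    · obtain rfl : i = 0 := by omega
      simpa [Reach] using h
  | succ l ih =>
    rintro x z hx hz ⟨y, hy, hxy, hyz⟩
    obtain ⟨p, hp0, hpl, hpQ, hpg⟩ := ih hx hy hxy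
    refine ⟨fun i ↦ if i ≤ l + 1 then p i else z, by simpa using hp0, by simp, fun i hi ↦ ?_,
      fun i hi ↦ ?_⟩
    · rcases hi.lt_or_eq with hi | rfl
      · simpa [Nat.lt_succ_iff.1 hi] using hpQ i (by omega)
      · simpa [add_assoc, one_add_one_eq_two] using hz
    · rcases hi.lt_or_eq with hi | rfl
      · simpa [Nat.lt_succ_iff.1 hi, hi.le] using hpg i (by omega)
      · simpa [hpl, add_assoc] using hyz

lemma Reach.exists_closed_walk {x z : α} (h : Reach Q g (m + 1) n x z) (hx : x ∈ Q (m + 1))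
    (hz : z ∈ Q m) (hzx : g m z x) :
    ∃ e : ZMod (n + 2) → α, (∀ a, e a ∈ Q a) ∧ ∀ a, g a (e a) (e (a + 1)) := by
  have hlast : m + 1 + ((n + 1 : ℕ) : ZMod (n + 2)) = m := by
    have := ZMod.natCast_self (n + 2)
    push_cast at this ⊢
    linear_combination this
  obtain ⟨p, hp0, hpn, hpQ, hpg⟩ := h.exists_walk hx
    (by rwa [add_assoc (m + 1), ← Nat.cast_succ, hlast])
  have hlevel : ∀ a, m + 1 + ((a - (m + 1)).val : ZMod (n + 2)) = a := fun a ↦ by simp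
  refine ⟨fun a ↦ p (a - (m + 1)).val, fun a ↦ ?_, fun a ↦ ?_⟩
  · simpa [hlevel] using hpQ (a - (m + 1)).val (Nat.lt_succ_iff.1 (ZMod.val_lt _))
  · have hsucc : (a + 1 - (m + 1)).val = ((a - (m + 1)).val + 1) % (n + 2) := by
      rw [add_sub_right_comm, ZMod.val_add, ZMod.val_one'' (by omega)]
    beta_reduce
    rcases (Nat.lt_succ_iff.1 (ZMod.val_lt (a - (m + 1)))).lt_or_eq with hlt | heq
    · rw [hsucc, Nat.mod_eq_of_lt (by omega)]
      simpa [hlevel] using hpg (a - (m + 1)).val (Nat.lt_succ_iff.1 hlt)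
    · have ha : a = m := by rw [← hlevel a, heq, hlast]
      rw [hsucc, heq, Nat.mod_self, hp0, hpn, ha]
      exact hzx

theorem exists_closed_walk_or_splitAt (hne : ∀ m, (Q m).Nonempty)
    (hstep : ∀ m, ∀ x ∈ Q m, ∃ y ∈ Q (m + 1), g m x y)
    (hrect : ∀ m, RectangleClosed (g m) (Q m) (Q (m + 1))) :
    (∃ e : ZMod (n + 2) → α, (∀ a, e a ∈ Q a) ∧ ∀ a, g a (e a) (e (a + 1))) ∨
      ∀ m, SplitAt (g m) (Q m) (Q (m + 1)) := by
  refine or_iff_not_imp_left.2 fun hno m ↦ ?_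
  have hQm : m + 1 + n + 1 = m := by
    have := ZMod.natCast_self (n + 2)
    push_cast at this
    linear_combination this
  have hopen : ∀ z ∈ Q m, ∀ x ∈ Q (m + 1), Reach Q g (m + 1) n x z → ¬ g m z x :=
    fun z hz x hx hr hzx ↦ hno (hr.exists_closed_walk hx hz hzx)
  have hreach := exists_reach (m := m + 1) hstep n
  have hrect := rectangleClosed_reach (m := m + 1) hstep hrect n
  rw [hQm] at hreach hrect
  obtain ⟨x₀, hx₀⟩ := hne (m + 1)
  obtain ⟨z₀, hz₀, hr₀⟩ := hreach x₀ hx₀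
  obtain ⟨x₁, hx₁, hg₁⟩ := hstep m z₀ hz₀
  obtain ⟨z₁, hz₁, hr₁⟩ := hreach x₁ hx₁
  have hn : ¬ Reach Q g (m + 1) n x₁ z₀ := fun h ↦ hopen z₀ hz₀ x₁ hx₁ h hg₁
  refine ⟨z₀, hz₀, z₁, hz₁, x₀, hx₀, x₁, hx₁, hopen z₀ hz₀ x₀ hx₀ hr₀, hopen z₁ hz₁ x₁ hx₁ hr₁,
    hg₁, fun z hz ↦ ?_, fun x hx ↦ ?_⟩
  · by_contra! hc
    exact hrect x₁ hx₁ x₀ hx₀ z hz z₀ hz₀ (hopen z hz x₁ hx₁ · hc.2) hn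
      (hopen z hz x₀ hx₀ · hc.1) hr₀
  · by_contra! hc
    exact hrect x hx x₁ hx₁ z₀ hz₀ z₁ hz₁ (hopen z₀ hz₀ x hx · hc.1) (hopen z₁ hz₁ x hx · hc.2)
      hn hr₁

end ClosedWalk

/-! ### Blocked exchanges -/

section Component

variable {α : Type*} {R R' : α → α → Prop} {B S A X Y : Set α} {c x y z : α}

/-- `y` is `x` or joined to `x ∈ B` in the bipartite graph between `B` and its complement that is
given by `R`. -/
def Arrow (R : α → α → Prop) (B : Set α) (x y : α) : Prop :=
  x = y ∨ (x ∈ B ∧ y ∉ B ∧ R x y)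

/-- The elements `x` and `z` have a common out-neighbour in `S` with respect to `Arrow R B`. -/
def Linked (R : α → α → Prop) (B S : Set α) (x z : α) : Prop :=
  ∃ u ∈ S, Arrow R B x u ∧ Arrow R B z u

/-- The elements that can be reached from `c` by two links through `B`. For the exchanges in a base
`B` of a split matroid on `S`, this is the connected component of `c`. -/
def component (R : α → α → Prop) (B S : Set α) (c : α) : Set α :=
  {y | ∃ z ∈ B, Linked R B S c z ∧ Linked R B S z y}

lemma Arrow.mem_iff (hA : ∀ x ∈ B, ∀ y ∉ B, R x y → (x ∈ A ↔ y ∈ A)) (h : Arrow R B x y) :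
    x ∈ A ↔ y ∈ A := by
  rcases h with rfl | ⟨hx, hy, hxy⟩
  · rfl
  · exact hA x hx y hy hxy

lemma mem_iff_of_mem_component (hA : ∀ x ∈ B, ∀ y ∉ B, R x y → (x ∈ A ↔ y ∈ A))
    (hy : y ∈ component R B S c) : c ∈ A ↔ y ∈ A := by
  obtain ⟨z, -, ⟨u, -, hcu, hzu⟩, v, -, hzv, hyv⟩ := hy
  rw [hcu.mem_iff hA, ← hzu.mem_iff hA, hzv.mem_iff hA, ← hyv.mem_iff hA]

lemma self_mem_component (hcB : c ∈ B) (hcS : c ∈ S) : c ∈ component R B S c :=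
  have : Linked R B S c c := ⟨c, hcS, .inl rfl, .inl rfl⟩
  ⟨c, hcB, this, this⟩

lemma component_congr (h : ∀ x ∈ B, ∀ y ∈ S, y ∉ B → (R x y ↔ R' x y)) :
    component R B S c = component R' B S c := by
  have harrow : ∀ x, ∀ y ∈ S, (Arrow R B x y ↔ Arrow R' B x y) := fun x y hy ↦
    or_congr_right (and_congr_right fun hx ↦ and_congr_right fun hyB ↦ h x hx y hy hyB)
  have hlinked : ∀ x z, Linked R B S x z ↔ Linked R' B S x z := fun x z ↦
    exists_congr fun u ↦ and_congr_right fun hu ↦ and_congr (harrow x u hu) (harrow z u hu)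
  ext y
  simp only [component, hlinked]

lemma splitAt_or_exists_path (hX : ∀ x ∈ X, ∃ y ∈ Y, R x y) (hY : ∀ y ∈ Y, ∃ x ∈ X, R x y)
    (hc : c ∈ X) :
    SplitAt R X Y ∨ ∀ y ∈ Y, ∃ u ∈ Y, ∃ z ∈ X, R c u ∧ R z u ∧ R z y := by
  refine or_iff_not_imp_right.2 fun hno ↦ ?_
  push Not at hno
  obtain ⟨y, hy, hno⟩ := hno
  obtain ⟨u, hu, hcu⟩ := hX c hc
  obtain ⟨z, hz, hzy⟩ := hY y hy
  refine ⟨c, hc, z, hz, y, hy, u, hu, fun hcy ↦ hno y hy c hc hcy hcy hcy,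
    fun hzu ↦ hno u hu z hz hcu hzu hzy, hcu, fun x hx ↦ ?_, fun v hv ↦ ?_⟩
  · exact not_and_or.1 fun hx' ↦ hno u hu x hx hcu hx'.2 hx'.1
  · exact not_and_or.1 fun hv' ↦ hno v hv z hz hv'.1 hv'.2 hzy

lemma splitAt_or_subset_component (hAS : A ⊆ S) (hout : ∀ x ∈ B ∩ A, ∃ y ∈ A \ B, R x y)
    (hin : ∀ y ∈ A \ B, ∃ x ∈ B ∩ A, R x y) (hc : c ∈ B ∩ A) :
    SplitAt R (B ∩ A) (A \ B) ∨ A ⊆ component R B S c := by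
  refine (splitAt_or_exists_path hout hin hc).imp_right fun hpath y hy ↦ ?_
  by_cases hyB : y ∈ B
  · obtain ⟨v, hv, hyv⟩ := hout y ⟨hyB, hy⟩
    obtain ⟨u, hu, z, hz, hcu, hzu, hzv⟩ := hpath v hv
    exact ⟨z, hz.1, ⟨u, hAS hu.1, .inr ⟨hc.1, hu.2, hcu⟩, .inr ⟨hz.1, hu.2, hzu⟩⟩,
      v, hAS hv.1, .inr ⟨hz.1, hv.2, hzv⟩, .inr ⟨hyB, hv.2, hyv⟩⟩
  · obtain ⟨u, hu, z, hz, hcu, hzu, hzy⟩ := hpath y ⟨hy, hyB⟩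
    exact ⟨z, hz.1, ⟨u, hAS hu.1, .inr ⟨hc.1, hu.2, hcu⟩, .inr ⟨hz.1, hu.2, hzu⟩⟩,
      y, hAS hy, .inr ⟨hz.1, hyB, hzy⟩, .inl rfl⟩

end Component

namespace SplitSummand

variable {α : Type*} [DecidableEq α] {M : Matroid α} {C : SplitSummand M} {W W' : Finset α}
  {Q Q' Q'' : Finset α} {F G F' G' : C.Index} {c : α}

/-- The summand is the direct sum of two uniform matroids, with ground sets `H F` and `H G`. -/
structure IsUniformPair (C : SplitSummand M) (F G : C.Index) : Prop where
  subset_union : C.ground ⊆ C.H F ∪ C.H G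
  disjoint : Disjoint (C.H F) (C.H G)
  ρ_add_ρ : C.ρ F + C.ρ G = C.rank

lemma card_inter_H_add_card_inter_H (hW : M.IsBase (W : Set α)) (hFG : Disjoint (C.H F) (C.H G))
    (h : W ∩ C.ground ⊆ C.H F ∪ C.H G) : #(W ∩ C.H F) + #(W ∩ C.H G) = C.rank := by
  rw [← C.card_inter_ground hW, ← card_union_of_disjoint
    (hFG.mono inter_subset_right inter_subset_right), ← inter_union_distrib_left]
  congr 1
  have := C.H_subset F
  have := C.H_subset G
  grind

lemma tight_of_card_eq (hW : M.IsBase (W : Set α))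
    (h : #(W ∩ C.H F) + #(W ∩ C.H G) = C.ρ F + C.ρ G) : C.Tight W F ∧ C.Tight W G := by
  have hF := C.card_inter_H_le hW F
  have hG := C.card_inter_H_le hW G
  unfold Tight
  omega

lemma DoublyTight.disjoint (h : C.DoublyTight W Q Q' F G) (hQ : W ∩ C.ground ⊆ Q) :
    Disjoint (C.H F) (C.H G) := by
  rw [disjoint_left]
  intro x hxF hxG
  have hx := h.mem_of_mem_H hxF hxG
  exact (h.notMem_or x (hQ (mem_inter.2 ⟨hx, C.H_subset F hxF⟩))).elim (· hxF) (· hxG)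

lemma DoublyTight.ρ_add_ρ (h : C.DoublyTight W Q Q' F G) (hQ : W ∩ C.ground ⊆ Q) :
    C.ρ F + C.ρ G = C.rank := by
  rw [← card_inter_H_add_card_inter_H h.isBase (h.disjoint hQ) fun x hx ↦
    mem_union.2 (h.mem_H_or (mem_inter.1 hx).1 (mem_inter.1 hx).2), h.tight_left, h.tight_right]

lemma DoublyTight.isUniformPair (h : C.DoublyTight W Q Q' F G) (hQ : W ∩ C.ground ⊆ Q)
    (hcover : C.ground ⊆ C.H F ∪ C.H G) : C.IsUniformPair F G :=
  ⟨hcover, h.disjoint hQ, h.ρ_add_ρ hQ⟩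

lemma DoublyTight.next (h : C.DoublyTight W Q Q' F G) (hQ : W ∩ C.ground ⊆ Q)
    (h' : C.DoublyTight W' Q' Q'' F' G') (hQ' : W' ∩ C.ground ⊆ Q') :
    C.DoublyTight W' Q' Q'' F G := by
  have hdisj := h.disjoint hQ
  obtain ⟨hF, hG⟩ : C.Tight W' F ∧ C.Tight W' G := by
    refine tight_of_card_eq h'.isBase ((card_inter_H_add_card_inter_H h'.isBase hdisj
      fun x hx ↦ ?_).trans (h.ρ_add_ρ hQ).symm)
    exact mem_union.2 (h.mem_or x (hQ' hx))
  have heq : ∀ j, C.Tight W' j → (∃ z ∈ Q', z ∉ C.H j) → j = F ∨ j = G := by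
    rintro j hj ⟨z, hz, hzj⟩
    have hzC := h'.subset_ground hz
    by_cases hzF : z ∈ C.H F
    · exact .inr (hj.eq_of_notMem h'.isBase hG (h'.subset hz) hzC hzj (disjoint_left.1 hdisj hzF))
    · exact .inl (hj.eq_of_notMem h'.isBase hF (h'.subset hz) hzC hzj hzF)
  have hne := h'.ne
  rcases heq F' h'.tight_left h'.exists_notMem_left with rfl | rfl <;>
    rcases heq G' h'.tight_right h'.exists_notMem_right with rfl | rfl
  · exact absurd rfl hne
  · exact h'
  · exact h'.symm
  · exact absurd rfl hne

namespace IsUniformPair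

lemma symm (h : C.IsUniformPair F G) : C.IsUniformPair G F :=
  ⟨union_comm (C.H F) _ ▸ h.subset_union, h.disjoint.symm, add_comm (C.ρ F) _ ▸ h.ρ_add_ρ⟩

lemma tight (h : C.IsUniformPair F G) (hW : M.IsBase (W : Set α)) :
    C.Tight W F ∧ C.Tight W G :=
  tight_of_card_eq hW <| (card_inter_H_add_card_inter_H hW h.disjoint
    (inter_subset_right.trans h.subset_union)).trans h.ρ_add_ρ.symm

/-- The first of the two uniform matroids. -/
def left (h : C.IsUniformPair F G) : SplitSummand M where
  ground := C.H F
  rank := C.ρ F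
  Index := Empty
  H := nofun
  ρ := nofun
  ground_subset := (coe_subset.2 (C.H_subset F)).trans C.ground_subset
  H_subset := nofun
  card_inter_add_rank_le := nofun
  card_inter_ground hW := (h.tight hW).1
  card_inter_H_le _ := nofun
  exchanges {W x y} hW hx hy hxF hyF _ := by
    rw [exchanges_iff hW hx hy (C.H_subset F hxF) (C.H_subset F hyF)]
    rintro j ⟨hj, hxj, hyj⟩
    obtain rfl := (h.tight hW).1.eq_of_mem hW hj hy hyF hyj
    exact hxj hxF

end IsUniformPair

lemma ground_subset_component_or_isUniformPair {B : Finset α} (hB : M.IsBase (B : Set α))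
    (hout : ∀ x ∈ M.E, ∃ X : Finset α, M.IsBase (X : Set α) ∧ x ∉ X)
    (hin : ∀ x ∈ M.E, ∃ X : Finset α, M.IsBase (X : Set α) ∧ x ∈ X) (hc : c ∈ B)
    (hcC : c ∈ C.ground) :
    (C.ground : Set α) ⊆ component (Exchanges M B) B M.E c ∨ ∃ F G, C.IsUniformPair F G := by
  have hs : C.Separates B (B ∩ C.ground) (C.ground \ B) :=
    ⟨hB, inter_subset_left, fun y hy ↦ (mem_sdiff.1 hy).2, inter_subset_right, sdiff_subset⟩
  have hmem : ∀ x ∈ B, ∀ y ∉ B, Exchanges M B x y → (x ∈ C.ground ↔ y ∈ C.ground) :=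
    fun x hx y hy h ↦ C.mem_ground_iff_of_exchanges hB h hx hy
  refine
    (splitAt_or_subset_component (A := C.ground) C.ground_subset ?_ ?_ ⟨hc, hcC⟩).symm.imp_right
    fun h ↦ ?_
  · rintro x ⟨hx, hxC⟩
    obtain ⟨X, hX, hxX⟩ := hout x (C.ground_subset hxC)
    obtain ⟨y, -, hy, hxy⟩ := exists_exchanges hB hX hx hxX
    exact ⟨y, ⟨(hmem x hx y hy hxy).1 hxC, hy⟩, hxy⟩
  · rintro y ⟨hyC, hy⟩
    obtain ⟨Y, hY, hyY⟩ := hin y (C.ground_subset hyC)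
    obtain ⟨x, hx, hxy⟩ := exists_exchanges_of_notMem hB hY hyY hy
    exact ⟨x, ⟨hx, (hmem x hx y hy hxy).2 hyC⟩, hxy⟩
  · rw [← coe_inter, ← coe_sdiff] at h
    obtain ⟨F, G, hFG⟩ := hs.exists_doublyTight h
    refine ⟨F, G, hFG.isUniformPair Subset.rfl fun x hx ↦ mem_union.2 ?_⟩
    by_cases hxB : x ∈ B
    · exact hFG.mem_H_or hxB hx
    · exact hFG.mem_or x (mem_sdiff.2 ⟨hx, hxB⟩)

lemma mem_ground_iff_of_mem_component {B : Finset α} (hB : M.IsBase (B : Set α)) {x : α}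
    (hx : x ∈ component (Exchanges M B) B M.E c) : c ∈ C.ground ↔ x ∈ C.ground :=
  mem_iff_of_mem_component (A := C.ground)
    (fun _ hx _ hy hxy ↦ C.mem_ground_iff_of_exchanges hB hxy hx hy) hx

lemma ground_eq_ground {B : Finset α} (hB : M.IsBase (B : Set α)) {C C' : SplitSummand M}
    {c c' x : α} (hC : (C.ground : Set α) = component (Exchanges M B) B M.E c)
    (hC' : (C'.ground : Set α) = component (Exchanges M B) B M.E c') (hx : x ∈ C.ground)
    (hx' : x ∈ C'.ground) : (C.ground : Set α) = C'.ground := by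
  have hmem : ∀ {y}, y ∈ C.ground ↔ y ∈ component (Exchanges M B) B M.E c := by simp [← hC]
  have hmem' : ∀ {y}, y ∈ C'.ground ↔ y ∈ component (Exchanges M B) B M.E c' := by simp [← hC']
  have hc : c ∈ C'.ground := (mem_ground_iff_of_mem_component hB (hmem.1 hx)).2 hx'
  have hc' : c' ∈ C.ground := (mem_ground_iff_of_mem_component hB (hmem'.1 hx')).2 hx
  ext y
  exact ⟨fun hy ↦ (mem_ground_iff_of_mem_component hB (hmem.1 hy)).1 hc,
    fun hy ↦ (mem_ground_iff_of_mem_component hB (hmem'.1 hy)).1 hc'⟩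

lemma exists_ground_eq_component {B : Finset α} (hB : M.IsBase (B : Set α))
    (hM : ∀ x ∈ M.E, ∃ C : SplitSummand M, x ∈ C.ground)
    (hout : ∀ x ∈ M.E, ∃ X : Finset α, M.IsBase (X : Set α) ∧ x ∉ X)
    (hin : ∀ x ∈ M.E, ∃ X : Finset α, M.IsBase (X : Set α) ∧ x ∈ X) (hc : c ∈ B) :
    ∃ C : SplitSummand M, (C.ground : Set α) = component (Exchanges M B) B M.E c := by
  have heq : ∀ C : SplitSummand M, c ∈ C.ground →
      (C.ground : Set α) ⊆ component (Exchanges M B) B M.E c →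
      (C.ground : Set α) = component (Exchanges M B) B M.E c := fun C hcC h ↦
    h.antisymm fun y hy ↦ (mem_iff_of_mem_component (A := C.ground)
      (fun _ hx _ hy h ↦ C.mem_ground_iff_of_exchanges hB h hx hy) hy).1 hcC
  obtain ⟨C, hcC⟩ := hM c (hB.subset_ground hc)
  rcases C.ground_subset_component_or_isUniformPair hB hout hin hc hcC with h | ⟨F, G, h⟩
  · exact ⟨C, heq C hcC h⟩
  wlog hcF : c ∈ C.H F generalizing F G
  · exact this G F h.symm ((mem_union.1 (h.subset_union hcC)).resolve_left hcF)
  rcases h.left.ground_subset_component_or_isUniformPair hB hout hin hc hcF with h' | ⟨F', -⟩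
  · exact ⟨h.left, heq h.left hcF h'⟩
  · exact F'.elim

end SplitSummand

/-! ### Systems of prefixes of the blocks -/

section PrefixSystem

variable {α : Type*} [DecidableEq α] {n : ℕ} {B P : ZMod (n + 2) → Finset α} {e : ZMod (n + 2) → α}
  {m : ZMod (n + 2)} {f : α}

/-- The part of the block `B m` that follows its prefix `P m`. As the construction is cyclic, the
blocks are indexed by `ZMod (n + 2)`; a single block, which does not need it, is left out. -/
def rest (B P : ZMod (n + 2) → Finset α) (m : ZMod (n + 2)) : Finset α := B m \ P m

/-- The interval that starts behind the prefix of the block `B m` and ends with the prefix of the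
next block. -/
def window (B P : ZMod (n + 2) → Finset α) (m : ZMod (n + 2)) : Finset α := rest B P m ∪ P (m + 1)

/-- The prefixes `P`, each prolonged by one element. -/
def extend (P : ZMod (n + 2) → Finset α) (e : ZMod (n + 2) → α) (m : ZMod (n + 2)) : Finset α :=
  insert (e m) (P m)

/-- A cyclic arrangement of bases that cover `M` and of prefixes of them, such that the intervals
between consecutive ends of prefixes are bases. -/
structure IsPrefixSystem (M : Matroid α) (B P : ZMod (n + 2) → Finset α) : Prop where
  isBase : ∀ m, M.IsBase (B m : Set α)
  disjoint : ∀ m, Disjoint (B m) (B (m + 1))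
  exists_mem : ∀ x ∈ M.E, ∃ m, x ∈ B m
  subset : ∀ m, P m ⊆ B m
  isBase_window : ∀ m, M.IsBase (window B P m : Set α)

/-- Inside of `A`, the exchanges in all windows have the shape that can obstruct the choice of
elements to prolong the prefixes by. -/
def Blocked (M : Matroid α) (B P : ZMod (n + 2) → Finset α) (A : Set α) : Prop :=
  ∀ m, SplitAt (Exchanges M (window B P m)) (rest B P m ∩ A) (rest B P (m + 1) ∩ A)

/-- No component of `M` is blocked. -/
def IsUnblocked (M : Matroid α) (B P : ZMod (n + 2) → Finset α) : Prop :=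
  ∀ c ∈ B 0, ¬ Blocked M B P (component (Exchanges M (B 0)) (B 0) M.E c)

lemma add_one_ne_self (m : ZMod (n + 2)) : m + 1 ≠ m :=
  have : Fact (1 < n + 2) := ⟨by omega⟩
  add_ne_left.2 one_ne_zero

lemma mem_rest {x : α} : x ∈ rest B P m ↔ x ∈ B m ∧ x ∉ P m := mem_sdiff

lemma rest_subset_window : rest B P m ⊆ window B P m := subset_union_left

lemma rest_extend : rest B (extend P e) m = (rest B P m).erase (e m) := by
  ext x
  simp only [mem_rest, extend, mem_insert, mem_erase]
  tauto

lemma mem_rest_of_mem_rest_extend (hf : f ∈ rest B (extend P e) m) : f ∈ rest B P m := by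
  rw [rest_extend] at hf
  exact mem_of_mem_erase hf

namespace IsPrefixSystem

variable {M : Matroid α}

lemma notMem_block_add_one (h : IsPrefixSystem M B P) {x : α} (hx : x ∈ B m) : x ∉ B (m + 1) :=
  disjoint_left.1 (h.disjoint m) hx

lemma notMem_window (h : IsPrefixSystem M B P) {x : α} (hx : x ∈ rest B P (m + 1)) :
    x ∉ window B P m := by
  rw [mem_rest] at hx
  rw [window, mem_union, not_or]
  exact ⟨fun hxm ↦ h.notMem_block_add_one (mem_rest.1 hxm).1 hx.1, hx.2⟩

lemma window_extend (h : IsPrefixSystem M B P) (he : ∀ a, e a ∈ rest B P a) :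
    window B (extend P e) m = exchange (window B P m) (e m) (e (m + 1)) := by
  have heP : e m ∉ P (m + 1) := fun hP ↦
    h.notMem_block_add_one (mem_rest.1 (he m)).1 (h.subset _ hP)
  ext x
  simp only [window, mem_exchange, mem_union, rest_extend, extend, mem_insert, mem_erase]
  grind

lemma extend_iff (h : IsPrefixSystem M B P) (he : ∀ a, e a ∈ rest B P a) :
    IsPrefixSystem M B (extend P e) ↔ ∀ m, Exchanges M (window B P m) (e m) (e (m + 1)) := by
  have hwindow : ∀ m, Exchanges M (window B P m) (e m) (e (m + 1)) ↔
      M.IsBase (window B (extend P e) m : Set α) := fun m ↦ by rw [h.window_extend he, Exchanges]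
  exact ⟨fun h' m ↦ (hwindow m).2 (h'.isBase_window m), fun hexch ↦ ⟨h.isBase, h.disjoint,
    h.exists_mem, fun m ↦ insert_subset (mem_rest.1 (he m)).1 (h.subset m),
    fun m ↦ (hwindow m).1 (hexch m)⟩⟩

lemma exists_base_notMem (h : IsPrefixSystem M B P) {x : α} (hx : x ∈ M.E) :
    ∃ X : Finset α, M.IsBase (X : Set α) ∧ x ∉ X :=
  (h.exists_mem x hx).elim fun m hm ↦
    ⟨B (m + 1), h.isBase _, h.notMem_block_add_one hm⟩

lemma exists_ground_eq_component (h : IsPrefixSystem M B P)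
    (hM : ∀ x ∈ M.E, ∃ C : SplitSummand M, x ∈ C.ground) {c : α} (hc : c ∈ B 0) :
    ∃ C : SplitSummand M, (C.ground : Set α) = component (Exchanges M (B 0)) (B 0) M.E c :=
  SplitSummand.exists_ground_eq_component (h.isBase 0) hM (fun _ ↦ h.exists_base_notMem)
    (fun x hx ↦ (h.exists_mem x hx).elim fun m hm ↦ ⟨B m, h.isBase m, hm⟩) hc

variable {C : SplitSummand M}

lemma separates (h : IsPrefixSystem M B P) (C : SplitSummand M) (m : ZMod (n + 2)) :
    C.Separates (window B P m) (rest B P m ∩ C.ground) (rest B P (m + 1) ∩ C.ground) :=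
  ⟨h.isBase_window m, inter_subset_left.trans rest_subset_window,
    fun _ hy ↦ h.notMem_window (mem_inter.1 hy).1, inter_subset_right, inter_subset_right⟩

lemma blocked_iff (h : IsPrefixSystem M B P) :
    Blocked M B P C.ground ↔ ∀ m, ∃ F G, C.DoublyTight (window B P m) (rest B P m ∩ C.ground)
      (rest B P (m + 1) ∩ C.ground) F G :=
  forall_congr' fun m ↦ by
    rw [← (h.separates C m).splitAt_iff, coe_inter, coe_inter]

lemma card_rest_inter (h : IsPrefixSystem M B P) (C : SplitSummand M) (m : ZMod (n + 2)) :
    #(rest B P m ∩ C.ground) = #(rest B P 0 ∩ C.ground) := by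
  have hstep : ∀ m, #(rest B P (m + 1) ∩ C.ground) = #(rest B P m ∩ C.ground) := fun m ↦ by
    have hwindow := C.card_inter_ground (h.isBase_window m)
    have hblock := C.card_inter_ground (h.isBase (m + 1))
    rw [window, union_inter_distrib_right, card_union_of_disjoint] at hwindow
    · rw [← sdiff_union_of_subset (h.subset (m + 1)), union_inter_distrib_right,
        card_union_of_disjoint (sdiff_disjoint.mono inter_subset_left inter_subset_left)] at hblock
      exact Nat.add_right_cancel (hblock.trans hwindow.symm)
    · exact (h.disjoint m).mono (inter_subset_left.trans sdiff_subset)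
        (inter_subset_left.trans (h.subset _))
  obtain ⟨m, rfl⟩ := ZMod.natCast_zmod_surjective m
  induction m with
  | zero => rw [Nat.cast_zero]
  | succ m ih => rw [Nat.cast_succ, hstep, ih]

lemma exists_extend_or_blocked (h : IsPrefixSystem M B P)
    (hne : (rest B P 0 ∩ C.ground).Nonempty) :
    (∃ e, (∀ a, e a ∈ rest B P a) ∧ IsPrefixSystem M B (extend P e)) ∨
      Blocked M B P C.ground := by
  have hstep : ∀ m, ∀ x ∈ rest B P m ∩ C.ground, ∃ y ∈ rest B P (m + 1) ∩ C.ground,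
      Exchanges M (window B P m) x y := by
    intro m x hx
    rw [mem_inter] at hx
    have hxW := rest_subset_window hx.1
    obtain ⟨y, hy, hyW, hxy⟩ := exists_exchanges (h.isBase_window m) (h.isBase (m + 1)) hxW
      (h.notMem_block_add_one (mem_rest.1 hx.1).1)
    have hyC := (C.mem_ground_iff_of_exchanges (h.isBase_window m) hxy hxW hyW).1 hx.2
    exact ⟨y, mem_inter.2 ⟨mem_rest.2 ⟨hy, fun hP ↦ hyW (mem_union_right _ hP)⟩, hyC⟩, hxy⟩
  have hne : ∀ m, (rest B P m ∩ C.ground).Nonempty := fun m ↦ by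
    rwa [← card_pos, h.card_rest_inter C m, card_pos]
  rcases exists_closed_walk_or_splitAt hne hstep fun m ↦
    (h.separates C m).rectangleClosed with ⟨e, he, hexch⟩ | hs
  · have he' : ∀ a, e a ∈ rest B P a := fun a ↦ (mem_inter.1 (he a)).1
    exact .inl ⟨e, he', (h.extend_iff he').2 hexch⟩
  · exact .inr fun m ↦ by simpa only [coe_inter] using hs m

theorem exists_extend (h : IsPrefixSystem M B P)
    (hM : ∀ x ∈ M.E, ∃ C : SplitSummand M, x ∈ C.ground) (hP : IsUnblocked M B P)
    (hne : (rest B P 0).Nonempty) :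
    ∃ e, (∀ a, e a ∈ rest B P a) ∧ IsPrefixSystem M B (extend P e) := by
  obtain ⟨c, hc⟩ := hne
  have hcB := (mem_rest.1 hc).1
  obtain ⟨C, hC⟩ := h.exists_ground_eq_component hM hcB
  have hcC : c ∈ C.ground := by
    rw [← mem_coe, hC]
    exact self_mem_component hcB ((h.isBase 0).subset_ground hcB)
  exact (h.exists_extend_or_blocked ⟨c, mem_inter.2 ⟨hc, hcC⟩⟩).resolve_right (hC ▸ hP c hcB)

lemma mem_ground_iff_of_extend (h : IsPrefixSystem M B P) (he : ∀ a, e a ∈ rest B P a)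
    (h' : IsPrefixSystem M B (extend P e)) (a b : ZMod (n + 2)) :
    e a ∈ C.ground ↔ e b ∈ C.ground := by
  have hstep : ∀ m, e m ∈ C.ground ↔ e (m + 1) ∈ C.ground := fun m ↦
    C.mem_ground_iff_of_exchanges (h.isBase_window m) ((h.extend_iff he).1 h' m)
      (rest_subset_window (he m)) (h.notMem_window (he (m + 1)))
  have h0 : ∀ m, e m ∈ C.ground ↔ e 0 ∈ C.ground := fun m ↦ by
    obtain ⟨m, rfl⟩ := ZMod.natCast_zmod_surjective m
    induction m with
    | zero => rw [Nat.cast_zero]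
    | succ m ih => rw [Nat.cast_succ, ← hstep, ih]
  rw [h0 a, h0 b]

lemma blocked_of_extend (h : IsPrefixSystem M B P) (he : ∀ a, e a ∈ rest B P a)
    (h' : IsPrefixSystem M B (extend P e)) (heC : ∀ a, e a ∉ C.ground)
    (hb : Blocked M B (extend P e) C.ground) : Blocked M B P C.ground := by
  have hrest : ∀ m, rest B (extend P e) m ∩ C.ground = rest B P m ∩ C.ground := fun m ↦ by
    rw [rest_extend, erase_inter, erase_eq_of_notMem]
    exact fun hm ↦ heC m (mem_inter.1 hm).2
  have hwindow : ∀ m, window B (extend P e) m ∩ C.ground = window B P m ∩ C.ground := fun m ↦ by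
    ext x
    have : ∀ a, x ∈ C.ground → x ≠ e a := fun a hx hxe ↦ heC a (hxe ▸ hx)
    rw [h.window_extend he, mem_inter, mem_inter, mem_exchange]
    grind
  rw [h'.blocked_iff] at hb
  refine h.blocked_iff.2 fun m ↦ ?_
  obtain ⟨F, G, hFG⟩ := hb m
  rw [hrest, hrest] at hFG
  exact ⟨F, G, hFG.congr (h.separates C m) (hwindow m)⟩

section Update

variable {p : ZMod (n + 2)}

lemma window_extend_update_left (h : IsPrefixSystem M B P) (he : ∀ a, e a ∈ rest B P a) :
    window B (extend P (Function.update e (p + 1) f)) p =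
      exchange (window B (extend P e) p) (e (p + 1)) f := by
  have hd := h.notMem_window (he (p + 1))
  rw [window, mem_union, not_or] at hd
  ext x
  simp only [window, mem_exchange, mem_union, rest_extend, extend, mem_insert, mem_erase,
    Function.update_self, Function.update_of_ne (add_one_ne_self p).symm]
  grind

lemma window_extend_update_right (h : IsPrefixSystem M B P) (he : ∀ a, e a ∈ rest B P a)
    (hf : f ∈ rest B (extend P e) (p + 1)) :
    window B (extend P (Function.update e (p + 1) f)) (p + 1) =
      exchange (window B (extend P e) (p + 1)) f (e (p + 1)) := by
  have hd := he (p + 1)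
  rw [rest_extend, mem_erase] at hf
  have hfP : f ∉ P (p + 1 + 1) := fun hfP ↦
    h.notMem_block_add_one (mem_rest.1 hf.2).1 (h.subset _ hfP)
  have hfe : f ≠ e (p + 1 + 1) := fun hfe ↦
    h.notMem_block_add_one (mem_rest.1 hf.2).1 (hfe ▸ (mem_rest.1 (he _)).1)
  ext x
  simp only [window, mem_exchange, mem_union, rest_extend, extend, mem_insert, mem_erase,
    Function.update_self, Function.update_of_ne (add_one_ne_self (p + 1))]
  grind

lemma rest_extend_update (he : ∀ a, e a ∈ rest B P a) (hf : f ∈ rest B (extend P e) m) :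
    rest B (extend P (Function.update e m f)) m = exchange (rest B (extend P e) m) f (e m) := by
  have hd := he m
  rw [rest_extend, mem_erase] at hf
  ext x
  simp only [rest_extend, Function.update_self, mem_exchange, mem_erase]
  grind

lemma rest_extend_update_of_ne {a : ZMod (n + 2)} (ha : a ≠ m) :
    rest B (extend P (Function.update e m f)) a = rest B (extend P e) a := by
  rw [rest_extend, rest_extend, Function.update_of_ne ha]

end Update

end IsPrefixSystem

end PrefixSystem

namespace IsPrefixSystem

variable {α : Type*} [DecidableEq α] {n : ℕ} {B P : ZMod (n + 2) → Finset α} {e : ZMod (n + 2) → α}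
  {M : Matroid α} {C : SplitSummand M} {m p : ZMod (n + 2)} {f : α}

lemma update_mem_rest (he : ∀ a, e a ∈ rest B P a) (hf : f ∈ rest B P m) (a : ZMod (n + 2)) :
    Function.update e m f a ∈ rest B P a := by
  rcases eq_or_ne a m with rfl | ha
  · rwa [Function.update_self]
  · rw [Function.update_of_ne ha]
    exact he a

lemma extend_update (h : IsPrefixSystem M B P) (he : ∀ a, e a ∈ rest B P a)
    (h' : IsPrefixSystem M B (extend P e)) (hf : f ∈ rest B (extend P e) (p + 1))
    (hl : Exchanges M (window B (extend P e) p) (e (p + 1)) f)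
    (hr : Exchanges M (window B (extend P e) (p + 1)) f (e (p + 1))) :
    IsPrefixSystem M B (extend P (Function.update e (p + 1) f)) where
  isBase := h.isBase
  disjoint := h.disjoint
  exists_mem := h.exists_mem
  subset m :=
    insert_subset
      (mem_rest.1 (update_mem_rest he (mem_rest_of_mem_rest_extend hf) m)).1 (h.subset m)
  isBase_window m := by
    by_cases hm : m = p + 1
    · rw [hm, h.window_extend_update_right he hf]
      exact hr
    by_cases hm' : m = p
    · rw [hm', h.window_extend_update_left he]
      exact hl
    have hm'' : m + 1 ≠ p + 1 := fun hp ↦ hm' (add_right_cancel hp)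
    have : window B (extend P (Function.update e (p + 1) f)) m = window B (extend P e) m := by
      simp only [window, rest, extend, Function.update_of_ne hm, Function.update_of_ne hm'']
    rw [this]
    exact h'.isBase_window m

lemma exists_update_of_doublyTight {Fl Gl Fr Gr : C.Index} (h : IsPrefixSystem M B P)
    (he : ∀ a, e a ∈ rest B P a) (h' : IsPrefixSystem M B (extend P e))
    (hl : C.DoublyTight (window B (extend P e) p) (rest B (extend P e) p ∩ C.ground)
      (rest B (extend P e) (p + 1) ∩ C.ground) Fl Gl)
    (hr : C.DoublyTight (window B (extend P e) (p + 1)) (rest B (extend P e) (p + 1) ∩ C.ground)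
      (rest B (extend P e) (p + 1 + 1) ∩ C.ground) Fr Gr) (heC : e (p + 1) ∈ C.ground)
    (hd : (e (p + 1) ∉ C.H Fr ∧ e (p + 1) ∉ C.H Gr) ∨
      (e (p + 1) ∈ C.H Fl ∧ e (p + 1) ∈ C.H Gl)) :
    ∃ f ∈ rest B P (p + 1), IsPrefixSystem M B (extend P (Function.update e (p + 1) f)) ∧
      ¬ Blocked M B (extend P (Function.update e (p + 1) f)) C.ground := by
  have hdl : e (p + 1) ∈ window B (extend P e) p := mem_union_right _ (mem_insert_self _ _)
  have hdr : e (p + 1) ∉ window B (extend P e) (p + 1) := by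
    rw [h.window_extend he, mem_exchange]
    rintro (hd | hd)
    · exact h.notMem_block_add_one (mem_rest.1 (he (p + 1))).1 (hd ▸ (mem_rest.1 (he _)).1)
    · exact hd.1 rfl
  obtain ⟨f, hf, hfl, hfr, hno⟩ := hl.exists_exchange hr heC hdl hdr hd
  rw [mem_inter] at hf
  have h'' := h.extend_update he h' hf.1 hfl hfr
  refine ⟨f, mem_rest_of_mem_rest_extend hf.1, h'', fun hb ↦ ?_⟩
  rw [h''.blocked_iff] at hb
  have hQ : exchange (rest B (extend P e) (p + 1) ∩ C.ground) f (e (p + 1)) =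
      rest B (extend P (Function.update e (p + 1) f)) (p + 1) ∩ C.ground := by
    rw [rest_extend_update he hf.1, exchange, exchange, insert_inter_of_mem heC, erase_inter]
  obtain ⟨F, G, hFG⟩ := hb p
  obtain ⟨F', G', hFG'⟩ := hb (p + 1)
  rw [h.window_extend_update_left he, ← hQ,
    rest_extend_update_of_ne (add_one_ne_self p).symm] at hFG
  rw [h.window_extend_update_right he hf.1, ← hQ,
    rest_extend_update_of_ne (add_one_ne_self (p + 1))] at hFG'
  exact hno.elim (· F G hFG) (· F' G' hFG')

lemma exists_update (h : IsPrefixSystem M B P) (he : ∀ a, e a ∈ rest B P a)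
    (h' : IsPrefixSystem M B (extend P e)) (heC : ∀ a, e a ∈ C.ground)
    (hb : Blocked M B (extend P e) C.ground) (hP : ¬ Blocked M B P C.ground) :
    ∃ m, ∃ f ∈ rest B P m, IsPrefixSystem M B (extend P (Function.update e m f)) ∧
      ¬ Blocked M B (extend P (Function.update e m f)) C.ground := by
  choose F G hFG using h'.blocked_iff.1 hb
  -- Otherwise the two constraints of each window have been doubly tight before the step, too.
  obtain ⟨m, hm⟩ : ∃ m, (e m ∈ C.H (F m) ∨ e m ∈ C.H (G m)) →
      e (m + 1) ∈ C.H (F m) ∧ e (m + 1) ∈ C.H (G m) := by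
    by_contra! hm
    refine hP (h.blocked_iff.2 fun m ↦ ⟨F m, G m, ?_⟩)
    refine SplitSummand.DoublyTight.of_exchange (x := e m) (y := e (m + 1)) ?_ (h.separates C m)
      (mem_inter.2 ⟨he m, heC m⟩) (mem_inter.2 ⟨he _, heC _⟩) (hm m).1
      (not_and_or.1 (not_and.2 (hm m).2))
    rw [← h.window_extend he, ← erase_inter, ← erase_inter, ← rest_extend, ← rest_extend]
    exact hFG m
  by_cases hem : e m ∈ C.H (F m) ∨ e m ∈ C.H (G m)
  · exact ⟨m + 1, h.exists_update_of_doublyTight he h' (hFG m) (hFG (m + 1)) (heC _)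
      (.inr (hm hem))⟩
  · obtain ⟨p, rfl⟩ : ∃ p, p + 1 = m := ⟨m - 1, sub_add_cancel m 1⟩
    exact ⟨p + 1, h.exists_update_of_doublyTight he h' (hFG p) (hFG (p + 1)) (heC _)
      (.inl (not_or.1 hem))⟩

theorem exists_isUnblocked_extend (h : IsPrefixSystem M B P)
    (hM : ∀ x ∈ M.E, ∃ C : SplitSummand M, x ∈ C.ground) (hP : IsUnblocked M B P)
    (he : ∀ a, e a ∈ rest B P a) (h' : IsPrefixSystem M B (extend P e)) :
    IsUnblocked M B (extend P e) ∨ ∃ m, ∃ f ∈ rest B P m,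
      IsPrefixSystem M B (extend P (Function.update e m f)) ∧
      IsUnblocked M B (extend P (Function.update e m f)) := by
  refine or_iff_not_imp_left.2 fun hbad ↦ ?_
  unfold IsUnblocked at hbad
  push Not at hbad
  obtain ⟨c, hc, hb⟩ := hbad
  obtain ⟨C, hC⟩ := h.exists_ground_eq_component hM hc
  have hPC : ¬ Blocked M B P C.ground := hC ▸ hP c hc
  rw [← hC] at hb
  have heC : ∀ a, e a ∈ C.ground := by
    by_contra! hno
    obtain ⟨a, ha⟩ := hno
    exact hPC (h.blocked_of_extend he h'
      (fun b hb ↦ ha ((h.mem_ground_iff_of_extend he h' a b).2 hb)) hb)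
  obtain ⟨m, f, hf, h'', hCf⟩ := h.exists_update he h' heC hb hPC
  refine ⟨m, f, hf, h'', fun c' hc' hb' ↦ ?_⟩
  obtain ⟨C', hC'⟩ := h.exists_ground_eq_component hM hc'
  rw [← hC'] at hb'
  have he' := update_mem_rest he hf
  have hCC' : ∀ a, Function.update e m f a ∉ C'.ground := by
    intro a ha
    have hm := (h.mem_ground_iff_of_extend he' h'' a (m + 1)).1 ha
    rw [Function.update_of_ne (add_one_ne_self m)] at hm
    exact hCf (SplitSummand.ground_eq_ground (h.isBase 0) hC hC' (heC _) hm ▸ hb')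
  exact hP c' hc' (hC' ▸ h.blocked_of_extend he' h'' hCC' hb')

theorem isUnblocked_empty (h : IsPrefixSystem M B fun _ ↦ ∅)
    (hM : ∀ x ∈ M.E, ∃ C : SplitSummand M, x ∈ C.ground) : IsUnblocked M B fun _ ↦ ∅ := by
  intro c hc hb
  obtain ⟨C, hC⟩ := h.exists_ground_eq_component hM hc
  rw [← hC, h.blocked_iff] at hb
  have hrest : ∀ m, rest B (fun _ ↦ ∅) m = B m := fun m ↦ sdiff_empty
  have hwindow : ∀ m, window B (fun _ ↦ ∅) m = B m := fun m ↦ by rw [window, hrest, union_empty]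
  simp only [hrest, hwindow] at hb
  obtain ⟨F, G, h0⟩ := hb 0
  have hpair : ∀ m, C.DoublyTight (B m) (B m ∩ C.ground) (B (m + 1) ∩ C.ground) F G := fun m ↦ by
    obtain ⟨m, rfl⟩ := ZMod.natCast_zmod_surjective m
    induction m with
    | zero => rwa [Nat.cast_zero]
    | succ m ih =>
      obtain ⟨F', G', h'⟩ := hb (m + 1)
      rw [Nat.cast_succ]
      exact ih.next Subset.rfl h' Subset.rfl
  have hFG : C.IsUniformPair F G := h0.isUniformPair Subset.rfl fun x hx ↦ by
    obtain ⟨m, hm⟩ := h.exists_mem x (C.ground_subset hx)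
    exact mem_union.2 ((hpair m).mem_H_or hm hx)
  obtain ⟨x, hx, hxF⟩ := h0.exists_notMem_left
  obtain ⟨y, hy, hyF⟩ := h0.exists_mem_left
  have hleft : ∀ {z}, z ∈ C.ground → (c ∈ C.H F ↔ z ∈ C.H F) := fun hz ↦
    SplitSummand.mem_ground_iff_of_mem_component (C := hFG.left) (h.isBase 0)
      (hC ▸ mem_coe.2 hz)
  exact hxF ((hleft (mem_inter.1 hx).2).1 ((hleft (mem_inter.1 hy).2).2 hyF))

end IsPrefixSystem

end SplitMatroid

namespace SplitMatroid

/-! ### The algorithm -/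

section Algorithm

variable {α : Type*}

/-- The `m`-th list, where indices are taken modulo the number of lists. -/
def cyclicGet (ls : List (List α)) (m : ℕ) : List α := ls.getD (m % ls.length) []

variable [DecidableEq α]

/-- The elements of the `m`-th block that are not in its prefix. As in the definitions below, `bs`
are the blocks and `ps` their prefixes. -/
def restList (bs ps : List (List α)) (m : ℕ) : List α :=
  (cyclicGet bs m).filter fun x ↦ x ∉ cyclicGet ps m

/-- The list version of `window`. -/
def windowList (bs ps : List (List α)) (m : ℕ) : List α :=
  restList bs ps m ++ cyclicGet ps (m + 1)

/-- The `m`-th window with its member `x` exchanged for `y`. -/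
def exchangeList (bs ps : List (List α)) (m : ℕ) (x y : α) : List α :=
  (restList bs ps m).filter (fun z ↦ z ≠ x) ++ (cyclicGet ps (m + 1) ++ [y])

/-- The blocks in order, each rearranged so that it starts with its prefix. -/
def arrange (bs ps : List (List α)) : List (List α) :=
  (List.range bs.length).map fun m ↦ cyclicGet ps m ++ restList bs ps m

/-- All windows belong to the list `T` of sets known to be independent. -/
def KnownWindows (T bs ps : List (List α)) : Prop := ∀ m < bs.length, windowList bs ps m ∈ T

/-- `component` for the exchanges in the first block, as far as they are known to give sets in
`T`. -/
def knownComponent (T bs : List (List α)) (c : α) : Set α :=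
  component (fun x y ↦ exchangeList bs [] 0 x y ∈ T) {x | x ∈ cyclicGet bs 0}
    {x | x ∈ bs.flatten} c

/-- `Blocked` for the exchanges known to give sets in `T`. -/
def KnownBlocked (T bs ps : List (List α)) (A : Set α) : Prop :=
  ∀ m < bs.length, SplitAt (fun x y ↦ exchangeList bs ps m x y ∈ T)
    {x | x ∈ restList bs ps m ∧ x ∈ A} {x | x ∈ restList bs ps (m + 1) ∧ x ∈ A}

/-- `IsUnblocked` for the exchanges known to give sets in `T`. -/
def KnownUnblocked (T bs ps : List (List α)) : Prop :=
  ∀ c ∈ cyclicGet bs 0, ¬ KnownBlocked T bs ps (knownComponent T bs c)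

/-- The sets that have to be tested in order to know the components. -/
def componentQueries (bs : List (List α)) : List (List α) :=
  (cyclicGet bs 0).flatMap fun x ↦ bs.flatten.map fun y ↦ exchangeList bs [] 0 x y

/-- The sets that have to be tested in order to know the exchanges in the windows. -/
def exchangeQueries (bs ps : List (List α)) : List (List α) :=
  (List.range bs.length).flatMap fun m ↦ (restList bs ps m).flatMap fun x ↦
    (restList bs ps (m + 1)).map fun y ↦ exchangeList bs ps m x y

/-- The oracle calls in a stage of the algorithm that starts with the candidates `cands`. -/
def queries (bs : List (List α)) (cands : List (List (List α))) : List (List α) :=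
  componentQueries bs ++ cands.flatMap (exchangeQueries bs)

/-- The ways to prolong the `m`-th prefix by one element. -/
def prolongations (bs ps : List (List α)) (m : ℕ) : List (List α) :=
  (restList bs ps m).map fun x ↦ cyclicGet ps m ++ [x]

open scoped Classical in
/-- The first unblocked candidate. -/
noncomputable def pick (T bs : List (List α)) (cands : List (List (List α))) : List (List α) :=
  (cands.filter fun ps ↦ KnownUnblocked T bs ps).headI

open scoped Classical in
/-- The first way to prolong all prefixes by one element each such that the windows are bases. The
search is exhaustive, as only the oracle calls of the algorithm count. -/
noncomputable def advance (T bs ps : List (List α)) : List (List α) :=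
  (((List.range bs.length).map (prolongations bs ps)).sections.filter fun ps' ↦
    KnownWindows T bs ps').headI

/-- The prolonged prefixes `ps'`, and all that arise from it by another choice in one block. -/
def variants (bs ps ps' : List (List α)) : List (List (List α)) :=
  ps' :: (List.range bs.length).flatMap fun m ↦ (prolongations bs ps m).map fun p ↦ ps'.set m p

open scoped Classical in
/-- The candidates for the next stage of the algorithm. -/
noncomputable def nextCands (T bs : List (List α)) (cands : List (List (List α))) :
    List (List (List α)) :=
  (variants bs (pick T bs cands) (advance T bs (pick T bs cands))).filter fun ps ↦
    KnownWindows T bs ps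

/-- The candidates of the algorithm that uses the oracle `O`, after `j` stages. All their prefixes
have `j` elements. -/
noncomputable def run (O : List α → Bool) (bs : List (List α)) : ℕ → List (List (List α))
  | 0 => [bs.map fun _ ↦ []]
  | j + 1 => nextCands ((queries bs (run O bs j)).filter O) bs (run O bs j)

end Algorithm

section Lists

variable {α : Type*} {ls : List (List α)} {m : ℕ}

lemma cyclicGet_of_lt (h : m < ls.length) : cyclicGet ls m = ls[m] := by
  rw [cyclicGet, Nat.mod_eq_of_lt h, List.getD_eq_getElem]

lemma cyclicGet_mod (ls : List (List α)) (m : ℕ) :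
    cyclicGet ls (m % ls.length) = cyclicGet ls m := by
  rw [cyclicGet, Nat.mod_mod, cyclicGet]

lemma cyclicGet_map {f : List α → List α} (hf : f [] = []) :
    cyclicGet (ls.map f) m = f (cyclicGet ls m) := by
  rw [cyclicGet, cyclicGet, List.length_map, ← List.getD_map (f := f), hf]

lemma cyclicGet_nil : cyclicGet ([] : List (List α)) m = [] := rfl

lemma coe_toFinset_eq [DecidableEq α] (l : List α) : (l.toFinset : Set α) = {x | x ∈ l} := by
  ext x
  rw [Finset.mem_coe, List.mem_toFinset, Set.mem_ofPred_eq]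

variable [DecidableEq α] {bs ps : List (List α)} {x y : α}

lemma mem_restList : x ∈ restList bs ps m ↔ x ∈ cyclicGet bs m ∧ x ∉ cyclicGet ps m := by
  rw [restList, List.mem_filter, decide_eq_true_eq]

lemma toFinset_restList : (restList bs ps m).toFinset =
    (cyclicGet bs m).toFinset \ (cyclicGet ps m).toFinset := by
  ext x
  rw [List.mem_toFinset, mem_restList, Finset.mem_sdiff, List.mem_toFinset, List.mem_toFinset]

lemma toFinset_exchangeList (hx : x ∉ cyclicGet ps (m + 1)) :
    (exchangeList bs ps m x y).toFinset = exchange (windowList bs ps m).toFinset x y := by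
  ext z
  simp only [exchangeList, windowList, mem_exchange, List.mem_toFinset, List.mem_append,
    List.mem_filter, List.mem_singleton, decide_eq_true_eq]
  grind

end Lists

/-! ### Correctness -/

section Flatten

variable {α : Type*} {ls : List (List α)} {r a i : ℕ}

lemma length_flatten_of_forall (hr : ∀ l ∈ ls, l.length = r) :
    ls.flatten.length = ls.length * r := by
  rw [List.length_flatten, List.map_congr_left hr, List.map_const', List.sum_replicate, smul_eq_mul]

lemma flatten_rotate (hr : ∀ l ∈ ls, l.length = r) :
    ls.flatten.rotate (a * r) = (ls.rotate a).flatten := by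
  induction a generalizing ls with
  | zero => rw [zero_mul, List.rotate_zero, List.rotate_zero]
  | succ a ih =>
    cases ls with
    | nil => rfl
    | cons l ls =>
      have hrot : ∀ l' ∈ ls ++ [l], l'.length = r := fun l' hl' ↦
        hr l' (by rwa [List.mem_append, or_comm, ← List.mem_append] at hl')
      rw [List.rotate_cons_succ, ← ih hrot, Nat.succ_mul, add_comm, ← List.rotate_rotate,
        List.flatten_cons, ← hr l List.mem_cons_self, List.rotate_append_length_eq,
        List.flatten_append, List.flatten_singleton]

lemma cyclicGet_rotate (m : ℕ) : cyclicGet (ls.rotate a) m = cyclicGet ls (m + a) := by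
  rcases ls.length.eq_zero_or_pos with h | h
  · rw [List.length_eq_zero_iff.1 h, List.rotate_nil, cyclicGet_nil, cyclicGet_nil]
  · rw [← cyclicGet_mod, ← cyclicGet_mod ls, List.length_rotate,
      cyclicGet_of_lt (by rw [List.length_rotate]; exact Nat.mod_lt m h),
      cyclicGet_of_lt (Nat.mod_lt _ h), List.getElem_rotate]
    simp only [Nat.mod_add_mod]

lemma take_rotate_flatten (hr : ∀ l ∈ ls, l.length = r) (hne : ls ≠ []) (hi : i ≤ r) :
    (ls.flatten.rotate i).take r = (cyclicGet ls 0).drop i ++ (cyclicGet ls 1).take i := by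
  obtain ⟨l, ls, rfl⟩ := List.exists_cons_of_ne_nil hne
  have hl : l.length = r := hr l List.mem_cons_self
  rw [List.flatten_cons, List.rotate_eq_drop_append_take (by rw [List.length_append]; omega),
    List.drop_append_of_le_length (by omega), List.take_append_of_le_length (l₁ := l) (by omega),
    List.append_assoc, List.take_append, List.length_drop, hl, Nat.sub_sub_self hi,
    List.take_of_length_le (by rw [List.length_drop]; omega), cyclicGet_of_lt (Nat.zero_lt_succ _)]
  cases ls with
  | nil =>
    rw [← cyclicGet_mod, List.length_singleton, Nat.mod_self, cyclicGet_of_lt (Nat.zero_lt_succ _),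
      List.flatten_nil, List.nil_append, List.take_take, min_self, List.getElem_cons_zero]
  | cons l' ls =>
    have hl' : l'.length = r := hr l' (by simp)
    rw [cyclicGet_of_lt (Nat.succ_lt_succ (Nat.zero_lt_succ _)), List.flatten_cons,
      List.append_assoc, List.take_append_of_le_length (by omega), List.getElem_cons_succ,
      List.getElem_cons_zero, List.getElem_cons_zero]

lemma take_rotate_flatten_add (hr : ∀ l ∈ ls, l.length = r) (hne : ls ≠ []) (hi : i ≤ r) :
    (ls.flatten.rotate (a * r + i)).take r =
      (cyclicGet ls a).drop i ++ (cyclicGet ls (a + 1)).take i := by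
  rw [← List.rotate_rotate, flatten_rotate hr, take_rotate_flatten
    (fun l hl ↦ hr l (List.mem_rotate.1 hl)) (mt List.rotate_eq_nil_iff.1 hne) hi,
    cyclicGet_rotate, cyclicGet_rotate, zero_add, add_comm 1]

lemma take_drop_flatten (hr : ∀ l ∈ ls, l.length = r) (ha : a < ls.length) :
    (ls.flatten.drop (a * r)).take r = cyclicGet ls a := by
  have hmul := Nat.mul_le_mul_right r (Nat.succ_le_of_lt ha)
  rw [Nat.succ_mul, ← length_flatten_of_forall hr] at hmul
  have h := take_rotate_flatten_add (a := a) hr (List.ne_nil_of_length_pos (Nat.zero_lt_of_lt ha))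
    (Nat.zero_le r)
  rwa [add_zero, List.rotate_eq_drop_append_take (by omega),
    List.take_append_of_le_length (by rw [List.length_drop]; omega), List.drop_zero,
    List.take_zero, List.append_nil] at h

end Flatten

section CyclicOrdering

variable {α : Type*} {M : Matroid α} {ls : List (List α)}

/-- The lists are without repetitions, and they are pairwise disjoint bases that cover `M`. -/
structure IsBaseList (M : Matroid α) (ls : List (List α)) : Prop where
  nodup_flatten : ls.flatten.Nodup
  isBase : ∀ l ∈ ls, M.IsBase {x | x ∈ l}
  mem_flatten : ∀ x, x ∈ ls.flatten ↔ x ∈ M.E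

lemma cyclicGet_mem (hls : ls.length ≠ 0) (m : ℕ) : cyclicGet ls m ∈ ls := by
  rw [← cyclicGet_mod, cyclicGet_of_lt (Nat.mod_lt m (Nat.pos_of_ne_zero hls))]
  exact List.getElem_mem _

lemma ncard_setOf_mem {l : List α} (hl : l.Nodup) : {x | x ∈ l}.ncard = l.length := by
  classical
  rw [← coe_toFinset_eq, Set.ncard_coe_finset, List.toFinset_card_of_nodup hl]

namespace IsBaseList

lemma length_eq_rk (h : IsBaseList M ls) {l : List α} (hl : l ∈ ls) : l.length = rk M := by
  rw [rk, ← (h.isBase l hl).encard_eq_eRank,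
    ← ncard_setOf_mem ((List.nodup_flatten.1 h.nodup_flatten).1 l hl), Set.ncard]

lemma ncard_ground (h : IsBaseList M ls) : M.E.ncard = ls.flatten.length := by
  rw [← ncard_setOf_mem h.nodup_flatten]
  exact congrArg Set.ncard (Set.ext fun x ↦ (h.mem_flatten x).symm)

lemma nodup_cyclicGet (h : IsBaseList M ls) (m : ℕ) : (cyclicGet ls m).Nodup := by
  rcases ls.length.eq_zero_or_pos with h0 | h0
  · rw [List.length_eq_zero_iff.1 h0]
    exact List.nodup_nil
  · rw [← cyclicGet_mod, cyclicGet_of_lt (Nat.mod_lt m h0)]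
    exact (List.nodup_flatten.1 h.nodup_flatten).1 _ (List.getElem_mem _)

lemma isCyclicOrdering (h : IsBaseList M ls)
    (hw : ∀ m, ∀ i < rk M, M.IsBase {x | x ∈ (cyclicGet ls m).drop i ++
      (cyclicGet ls (m + 1)).take i}) : IsCyclicOrdering M ls.flatten := by
  refine ⟨h.nodup_flatten, Set.ext h.mem_flatten, fun i hi ↦ ?_⟩
  have hr : ∀ l ∈ ls, l.length = rk M := fun l hl ↦ h.length_eq_rk hl
  have hr0 : 0 < rk M := by
    rw [length_flatten_of_forall hr] at hi
    exact Nat.pos_of_mul_pos_left (Nat.zero_lt_of_lt hi)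
  have hne : ls ≠ [] := by
    rintro rfl
    exact absurd hi (Nat.not_lt_zero i)
  rw [← Nat.div_add_mod' i (rk M), take_rotate_flatten_add hr hne (Nat.mod_lt i hr0).le]
  exact hw _ _ (Nat.mod_lt i hr0)

end IsBaseList

lemma IsBaseList.blocksInOrder {k : ℕ} {b : Fin k → List α}
    (h : IsBaseList M ls) (hlen : ls.length = k) (hb : ∀ i : Fin k, (cyclicGet ls i).Perm (b i)) :
    BlocksInOrder M (fun i ↦ {x | x ∈ b i}) ls.flatten := fun i ↦ by
  rw [take_drop_flatten (fun l hl ↦ h.length_eq_rk hl) (i.2.trans_eq hlen.symm)]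
  exact Set.ext fun x ↦ (hb i).mem_iff

lemma cyclicGet_ofFn {k : ℕ} {b : Fin k → List α} (i : Fin k) :
    cyclicGet (List.ofFn b) i = b i := by
  rw [cyclicGet_of_lt (i.2.trans_eq List.length_ofFn.symm), List.getElem_ofFn]

lemma IsBasePartition.isBaseList {k : ℕ} {b : Fin k → List α} (hb : ∀ i, (b i).Nodup)
    (h : IsBasePartition M fun i ↦ {x | x ∈ b i}) : IsBaseList M (List.ofFn b) where
  nodup_flatten := List.nodup_flatten.2 ⟨List.forall_mem_ofFn_iff.2 hb, List.pairwise_ofFn.2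
    fun _ _ hij _ hx hx' ↦ Set.disjoint_left.1 (h.2.1 hij.ne) hx hx'⟩
  isBase := List.forall_mem_ofFn_iff.2 h.1
  mem_flatten x := by
    rw [← h.2.2, Set.mem_iUnion, List.mem_flatten]
    simp only [List.mem_ofFn, exists_exists_eq_and, Set.mem_ofPred_eq]

end CyclicOrdering

section Arrange

variable {α : Type*} [DecidableEq α] {bs ps : List (List α)} {m : ℕ} {M : Matroid α}

lemma restList_mod (hps : ps.length = bs.length) (m : ℕ) :
    restList bs ps (m % bs.length) = restList bs ps m := by
  rw [restList, restList, cyclicGet_mod, ← hps, cyclicGet_mod]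

lemma length_arrange : (arrange bs ps).length = bs.length := by
  rw [arrange, List.length_map, List.length_range]

lemma cyclicGet_arrange (hps : ps.length = bs.length) (m : ℕ) :
    cyclicGet (arrange bs ps) m = cyclicGet ps m ++ restList bs ps m := by
  rcases bs.length.eq_zero_or_pos with h | h
  · rw [List.length_eq_zero_iff.1 h] at hps ⊢
    rw [List.length_eq_zero_iff.1 hps]
    rfl
  · have hm := Nat.mod_lt m h
    rw [← cyclicGet_mod, length_arrange, cyclicGet_of_lt (hm.trans_eq length_arrange.symm)]
    simp only [arrange, List.getElem_map, List.getElem_range]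
    rw [restList_mod hps, ← hps, cyclicGet_mod]

lemma arrange_map_nil : arrange bs (bs.map fun _ ↦ []) = bs := by
  refine List.ext_getElem length_arrange fun m hm hm' ↦ ?_
  have hnil : cyclicGet (bs.map fun _ ↦ []) m = [] := cyclicGet_map rfl
  rw [← cyclicGet_of_lt hm, cyclicGet_arrange (List.length_map _), restList, hnil, List.nil_append,
    ← cyclicGet_of_lt hm']
  exact List.filter_eq_self.2 fun x _ ↦ decide_eq_true List.not_mem_nil

lemma perm_append_restList (hbs : (cyclicGet bs m).Nodup) (hps : (cyclicGet ps m).Nodup)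
    (hsub : cyclicGet ps m ⊆ cyclicGet bs m) :
    (cyclicGet ps m ++ restList bs ps m).Perm (cyclicGet bs m) := by
  refine (List.perm_ext_iff_of_nodup (hps.append (hbs.filter _) fun x hx hx' ↦
    (mem_restList.1 hx').2 hx) hbs).2 fun x ↦ ?_
  change x ∈ _ ++ restList bs ps m ↔ _
  rw [List.mem_append, mem_restList]
  exact ⟨fun h ↦ h.elim (@hsub x) And.left, fun h ↦ or_iff_not_imp_left.2 fun hx ↦ ⟨h, hx⟩⟩

lemma IsBaseList.arrange (h : IsBaseList M bs) (hlen : ps.length = bs.length)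
    (hperm : ∀ m, (cyclicGet ps m ++ restList bs ps m).Perm (cyclicGet bs m)) :
    IsBaseList M (arrange bs ps) := by
  have hget : ∀ m (hm : m < (SplitMatroid.arrange bs ps).length) (hm' : m < bs.length),
      ((SplitMatroid.arrange bs ps)[m]).Perm bs[m] := fun m hm hm' ↦ by
    rw [← cyclicGet_of_lt hm, ← cyclicGet_of_lt hm', cyclicGet_arrange hlen]
    exact hperm m
  have hflatten := List.Perm.flatten_congr
    (List.forall₂_iff_get.2 ⟨length_arrange (ps := ps), hget⟩)
  refine ⟨hflatten.nodup_iff.2 h.nodup_flatten, fun l hl ↦ ?_, fun x ↦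
    hflatten.mem_iff.trans (h.mem_flatten x)⟩
  obtain ⟨m, hm, rfl⟩ := List.mem_iff_getElem.1 hl
  have hm' := hm.trans_eq length_arrange
  simpa only [(hget m hm hm').mem_iff] using h.isBase _ (List.getElem_mem hm')

lemma mem_sections_prolongations {ps' : List (List α)} :
    ps' ∈ ((List.range bs.length).map (prolongations bs ps)).sections ↔ ps'.length = bs.length ∧
      ∀ m < bs.length, ∃ x ∈ restList bs ps m, cyclicGet ps m ++ [x] = cyclicGet ps' m := by
  simp only [List.mem_sections, List.forall₂_iff_get, List.get_eq_getElem, List.getElem_map,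
    List.getElem_range, List.length_map, List.length_range, prolongations, List.mem_map]
  refine and_congr_right fun hlen ↦ forall_congr' fun m ↦ ⟨fun h hm ↦ ?_, fun h hm hm' ↦ ?_⟩
  · rw [cyclicGet_of_lt (hm.trans_eq hlen.symm)]
    exact h (hm.trans_eq hlen.symm) hm
  · rw [← cyclicGet_of_lt hm]
    exact h hm'

end Arrange

section Cycle

variable {α : Type*} {n : ℕ} {bs ps ps' : List (List α)} {m : ℕ} {x y f : α}
  {e : ZMod (n + 2) → α} {M : Matroid α}

lemma cyclicGet_val (hbs : bs.length = n + 2) (m : ℕ) :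
    cyclicGet bs (m : ZMod (n + 2)).val = cyclicGet bs m := by
  rw [ZMod.val_natCast, ← hbs, cyclicGet_mod]

lemma cyclicGet_set {ls : List (List α)} {l : List α} {a m : ℕ} (hm : m < ls.length) :
    cyclicGet (ls.set m l) a = if a % ls.length = m then l else cyclicGet ls a := by
  rw [cyclicGet, List.length_set, List.getD_eq_getElem?_getD, List.getElem?_set]
  split_ifs with h1 h2 h2
  · rfl
  · exact absurd h1 (Ne.symm h2)
  · exact absurd h2.symm h1
  · rw [cyclicGet, List.getD_eq_getElem?_getD]

/-- The lists `ps'` are the lists `ps`, prolonged by the elements `e`. -/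
structure Prolongs (ps ps' : List (List α)) (e : ZMod (n + 2) → α) : Prop where
  length_eq : ps'.length = n + 2
  cyclicGet_eq : ∀ m : ℕ, cyclicGet ps' m = cyclicGet ps m ++ [e m]

lemma Prolongs.set (h : Prolongs ps ps' e) (hps : ps.length = n + 2) (hm : m < n + 2) :
    Prolongs ps (ps'.set m (cyclicGet ps m ++ [f])) (Function.update e m f) where
  length_eq := by rw [List.length_set, h.length_eq]
  cyclicGet_eq a := by
    have heq : (a : ZMod (n + 2)) = m ↔ a % (n + 2) = m := by
      rw [ZMod.natCast_eq_natCast_iff', Nat.mod_eq_of_lt hm]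
    rw [cyclicGet_set (hm.trans_eq h.length_eq.symm), h.length_eq, h.cyclicGet_eq,
      Function.update_apply]
    simp only [heq]
    split_ifs with ham
    · rw [← ham, ← hps, cyclicGet_mod]
    · rfl

variable [DecidableEq α]

lemma forall_zmod {p : ZMod (n + 2) → Prop} : (∀ m, p m) ↔ ∀ m < n + 2, p (m : ℕ) :=
  ⟨fun h m _ ↦ h m, fun h m ↦ ZMod.natCast_zmod_val m ▸ h m.val m.val_lt⟩

/-- The sets that correspond to `n + 2` lists, as a cyclically indexed family. -/
def toCycle (n : ℕ) (ls : List (List α)) (m : ZMod (n + 2)) : Finset α :=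
  (cyclicGet ls m.val).toFinset

lemma toCycle_natCast (hbs : bs.length = n + 2) (m : ℕ) :
    toCycle n bs m = (cyclicGet bs m).toFinset := by
  rw [toCycle, cyclicGet_val hbs]

lemma rest_toCycle (hbs : bs.length = n + 2) (hps : ps.length = n + 2) (m : ℕ) :
    rest (toCycle n bs) (toCycle n ps) m = (restList bs ps m).toFinset := by
  rw [rest, toCycle_natCast hbs, toCycle_natCast hps, toFinset_restList]

lemma window_toCycle (hbs : bs.length = n + 2) (hps : ps.length = n + 2) (m : ℕ) :
    window (toCycle n bs) (toCycle n ps) m = (windowList bs ps m).toFinset := by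
  rw [window, rest_toCycle hbs hps, ← Nat.cast_succ, toCycle_natCast hps, windowList,
    List.toFinset_append]

lemma coe_rest_toCycle_inter (hbs : bs.length = n + 2) (hps : ps.length = n + 2) (m : ℕ)
    (A : Set α) : (rest (toCycle n bs) (toCycle n ps) m ∩ A : Set α) =
      {x | x ∈ restList bs ps m ∧ x ∈ A} := by
  rw [rest_toCycle hbs hps, coe_toFinset_eq]
  rfl

namespace Prolongs

lemma toCycle_eq (h : Prolongs ps ps' e) : toCycle n ps' = extend (toCycle n ps) e := by
  funext m
  rw [extend, toCycle, h.cyclicGet_eq, ZMod.natCast_zmod_val, toCycle, List.toFinset_append,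
    List.toFinset_cons, List.toFinset_nil, Finset.union_comm]
  rfl

lemma windowList_eq (h : Prolongs ps ps' e) (m : ℕ) :
    windowList bs ps' m = exchangeList bs ps m (e m) (e (m + 1 : ℕ)) := by
  rw [windowList, exchangeList, h.cyclicGet_eq, restList, h.cyclicGet_eq, restList,
    List.filter_filter]
  congr 2
  funext x
  simp only [List.mem_append, List.mem_singleton, not_or, Bool.decide_and, and_comm, decide_not]

lemma of_mem_sections (hbs : bs.length = n + 2) (hps : ps.length = n + 2)
    (h : ps' ∈ ((List.range bs.length).map (prolongations bs ps)).sections) :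
    ∃ e : ZMod (n + 2) → α, Prolongs ps ps' e ∧
      ∀ a, e a ∈ rest (toCycle n bs) (toCycle n ps) a := by
  obtain ⟨hlen, hget⟩ := mem_sections_prolongations.1 h
  choose e he heq using fun a : ZMod (n + 2) ↦ hget a.val (a.val_lt.trans_eq hbs.symm)
  refine ⟨e, ⟨hlen.trans hbs, fun m ↦ ?_⟩, forall_zmod.2 fun m hm ↦ ?_⟩
  · have hm := (heq m).symm
    rwa [cyclicGet_val (hlen.trans hbs), cyclicGet_val hps] at hm
  · have hm' := he m
    rwa [ZMod.val_natCast, Nat.mod_eq_of_lt hm, ← List.mem_toFinset,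
      ← rest_toCycle hbs hps] at hm'

lemma mem_sections (h : Prolongs ps ps' e) (hbs : bs.length = n + 2) (hps : ps.length = n + 2)
    (he : ∀ a, e a ∈ rest (toCycle n bs) (toCycle n ps) a) :
    ps' ∈ ((List.range bs.length).map (prolongations bs ps)).sections :=
  mem_sections_prolongations.2 ⟨h.length_eq.trans hbs.symm, fun m _ ↦
    ⟨e m, by rw [← List.mem_toFinset, ← rest_toCycle hbs hps]; exact he m,
      (h.cyclicGet_eq m).symm⟩⟩

end Prolongs

end Cycle

section Knowledge

variable {α : Type*} [DecidableEq α] {n m : ℕ} {T bs ps ps' : List (List α)} {x y : α}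
  {M : Matroid α} {e : ZMod (n + 2) → α}

/-- Of the sets in `Q`, exactly the independent ones belong to `T`. -/
def Answers (M : Matroid α) (Q T : List (List α)) : Prop :=
  ∀ X ∈ Q, X ∈ T ↔ M.Indep {x | x ∈ X}

lemma indep_exchangeList_iff (hW : M.IsBase ((windowList bs ps m).toFinset : Set α))
    (hx : x ∉ cyclicGet ps (m + 1)) (hy : y ∉ windowList bs ps m) :
    M.Indep {z | z ∈ exchangeList bs ps m x y} ↔
      Exchanges M (windowList bs ps m).toFinset x y := by
  rw [← coe_toFinset_eq, toFinset_exchangeList hx, Exchanges]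
  refine ⟨fun h ↦ ?_, Matroid.IsBase.indep⟩
  rw [exchange, Finset.coe_insert, Finset.coe_erase] at h ⊢
  exact hW.exchange_isBase_of_indep (by rwa [Finset.mem_coe, List.mem_toFinset]) h

lemma knownComponent_eq (hb : IsBaseList M bs) (hbs : bs.length = n + 2)
    (hT : Answers M (componentQueries bs) T) (c : α) : knownComponent T bs c =
      component (Exchanges M (toCycle n bs 0)) (toCycle n bs 0) M.E c := by
  have hwindow : windowList bs [] 0 = cyclicGet bs 0 := by
    rw [windowList, restList, cyclicGet_nil, cyclicGet_nil, List.append_nil]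
    exact List.filter_eq_self.2 fun x _ ↦ decide_eq_true List.not_mem_nil
  have hbase : M.IsBase ((cyclicGet bs 0).toFinset : Set α) := by
    rw [coe_toFinset_eq, cyclicGet_of_lt (by omega)]
    exact hb.isBase _ (List.getElem_mem _)
  have hE : {x | x ∈ bs.flatten} = M.E := Set.ext hb.mem_flatten
  rw [toCycle, ZMod.val_zero, coe_toFinset_eq, ← hE, knownComponent]
  refine component_congr fun x hx y hy hyB ↦ ?_
  rw [hT _ (List.mem_flatMap.2 ⟨x, hx, List.mem_map_of_mem hy⟩),
    indep_exchangeList_iff (by rwa [hwindow]) (by rw [cyclicGet_nil]; exact List.not_mem_nil)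
      (by rwa [hwindow]), hwindow]

variable (h : IsPrefixSystem M (toCycle n bs) (toCycle n ps)) (hbs : bs.length = n + 2)
  (hps : ps.length = n + 2) (hT : Answers M (exchangeQueries bs ps) T)
include h hbs hps hT

lemma mem_iff_exchanges (hm : m < n + 2) (hx : x ∈ restList bs ps m)
    (hy : y ∈ restList bs ps (m + 1)) : exchangeList bs ps m x y ∈ T ↔
      Exchanges M (window (toCycle n bs) (toCycle n ps) m) x y := by
  have hwindow := window_toCycle hbs hps m
  have hy' : y ∈ rest (toCycle n bs) (toCycle n ps) (m + 1) := by
    rw [← Nat.cast_succ, rest_toCycle hbs hps]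
    exact List.mem_toFinset.2 hy
  have hxP : x ∉ cyclicGet ps (m + 1) := fun hxP ↦ by
    rw [← List.mem_toFinset, ← toCycle_natCast hps, Nat.cast_succ] at hxP
    rw [← List.mem_toFinset, ← rest_toCycle hbs hps, mem_rest] at hx
    exact h.notMem_block_add_one hx.1 (h.subset _ hxP)
  have hQ : exchangeList bs ps m x y ∈ exchangeQueries bs ps :=
    List.mem_flatMap.2 ⟨m, List.mem_range.2 (hm.trans_eq hbs.symm),
      List.mem_flatMap.2 ⟨x, hx, List.mem_map_of_mem hy⟩⟩
  rw [hT _ hQ, hwindow]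
  refine indep_exchangeList_iff (hwindow ▸ h.isBase_window m) hxP ?_
  rw [← List.mem_toFinset, ← hwindow]
  exact h.notMem_window hy'

lemma knownBlocked_iff (A : Set α) :
    KnownBlocked T bs ps A ↔ Blocked M (toCycle n bs) (toCycle n ps) A := by
  rw [Blocked, forall_zmod, KnownBlocked, hbs]
  refine forall₂_congr fun m hm ↦ ?_
  rw [coe_rest_toCycle_inter hbs hps, ← Nat.cast_succ, coe_rest_toCycle_inter hbs hps]
  exact splitAt_congr fun x hx y hy ↦ mem_iff_exchanges h hbs hps hT hm hx.1 hy.1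

lemma knownUnblocked_iff (hb : IsBaseList M bs) (hT' : Answers M (componentQueries bs) T) :
    KnownUnblocked T bs ps ↔ IsUnblocked M (toCycle n bs) (toCycle n ps) := by
  rw [KnownUnblocked, IsUnblocked]
  refine forall_congr' fun c ↦ imp_congr ?_ (not_congr ?_)
  · rw [toCycle, ZMod.val_zero, List.mem_toFinset]
  · rw [knownComponent_eq hb hbs hT', knownBlocked_iff h hbs hps hT]

lemma Prolongs.knownWindows_iff (hp : Prolongs ps ps' e)
    (he : ∀ a, e a ∈ rest (toCycle n bs) (toCycle n ps) a) : KnownWindows T bs ps' ↔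
      IsPrefixSystem M (toCycle n bs) (extend (toCycle n ps) e) := by
  have hmem : ∀ m : ℕ, e m ∈ restList bs ps m := fun m ↦ by
    rw [← List.mem_toFinset, ← rest_toCycle hbs hps]
    exact he m
  rw [h.extend_iff he, forall_zmod, KnownWindows, hbs]
  refine forall₂_congr fun m hm ↦ ?_
  rw [hp.windowList_eq, mem_iff_exchanges h hbs hps hT hm (hmem m) (hmem (m + 1)), Nat.cast_succ]

end Knowledge

section Correctness

variable {α : Type*} [DecidableEq α] {n m j : ℕ} {T bs ps ps' : List (List α)}
  {cands : List (List (List α))} {M : Matroid α} {e : ZMod (n + 2) → α} {f : α}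

namespace IsBaseList

lemma isBase_toCycle (hb : IsBaseList M bs) (hbs : bs.length = n + 2) (m : ZMod (n + 2)) :
    M.IsBase (toCycle n bs m : Set α) := by
  rw [toCycle, coe_toFinset_eq]
  exact hb.isBase _ (cyclicGet_mem (hbs ▸ Nat.succ_ne_zero _) _)

lemma disjoint_toCycle (hb : IsBaseList M bs) (hbs : bs.length = n + 2) {a b : ZMod (n + 2)}
    (hab : a ≠ b) : Disjoint (toCycle n bs a) (toCycle n bs b) := by
  have ha := a.val_lt.trans_eq hbs.symm
  have hb' := b.val_lt.trans_eq hbs.symm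
  rw [toCycle, toCycle, cyclicGet_of_lt ha, cyclicGet_of_lt hb',
    List.disjoint_toFinset_iff_disjoint]
  have hpw := List.pairwise_iff_getElem.1 (List.nodup_flatten.1 hb.nodup_flatten).2
  rcases ((ZMod.val_injective (n + 2)).ne hab).lt_or_gt with h | h
  · exact hpw _ _ ha hb' h
  · exact (hpw _ _ hb' ha h).symm

lemma exists_mem_toCycle (hb : IsBaseList M bs) (hbs : bs.length = n + 2) {x : α} (hx : x ∈ M.E) :
    ∃ m, x ∈ toCycle n bs m := by
  obtain ⟨l, hl, hxl⟩ := List.mem_flatten.1 ((hb.mem_flatten x).2 hx)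
  obtain ⟨m, hm, rfl⟩ := List.mem_iff_getElem.1 hl
  exact ⟨m, by rwa [toCycle_natCast hbs, cyclicGet_of_lt hm, List.mem_toFinset]⟩

lemma isPrefixSystem_empty (hb : IsBaseList M bs) (hbs : bs.length = n + 2) :
    IsPrefixSystem M (toCycle n bs) fun _ ↦ ∅ where
  isBase := hb.isBase_toCycle hbs
  disjoint m := hb.disjoint_toCycle hbs (add_one_ne_self m).symm
  exists_mem _ := hb.exists_mem_toCycle hbs
  subset _ := Finset.empty_subset _
  isBase_window m := by
    rw [window, rest, Finset.sdiff_empty, Finset.union_empty]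
    exact hb.isBase_toCycle hbs m

end IsBaseList

/-- The lists `ps` are beginnings of length `j` of arrangements of the blocks `bs`, such that the
intervals that start up to `j` places behind the start of a block are bases. -/
structure IsPartialArrangement (M : Matroid α) (n : ℕ) (bs ps : List (List α)) (j : ℕ) : Prop where
  length_eq : ps.length = n + 2
  length_prefix : ∀ m, (cyclicGet ps m).length = j
  nodup_prefix : ∀ m, (cyclicGet ps m).Nodup
  isPrefixSystem_take :
    ∀ i ≤ j, IsPrefixSystem M (toCycle n bs) (toCycle n (ps.map (List.take i)))

lemma toCycle_map_nil : toCycle n (bs.map fun _ ↦ ([] : List α)) = fun _ ↦ ∅ :=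
  funext fun m ↦ by rw [toCycle, cyclicGet_map rfl, List.toFinset_nil]

lemma IsBaseList.isPartialArrangement_nil (hb : IsBaseList M bs) (hbs : bs.length = n + 2) :
    IsPartialArrangement M n bs (bs.map fun _ ↦ []) 0 where
  length_eq := (List.length_map _).trans hbs
  length_prefix m := by rw [cyclicGet_map rfl, List.length_nil]
  nodup_prefix m := by
    rw [cyclicGet_map rfl]
    exact List.nodup_nil
  isPrefixSystem_take i _ := by
    simp only [List.map_map, Function.comp_def, List.take_nil, toCycle_map_nil]
    exact hb.isPrefixSystem_empty hbs

namespace IsPartialArrangement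

lemma isPrefixSystem (h : IsPartialArrangement M n bs ps j) :
    IsPrefixSystem M (toCycle n bs) (toCycle n ps) := by
  have htake : toCycle n (ps.map (List.take j)) = toCycle n ps := funext fun m ↦ by
    rw [toCycle, cyclicGet_map List.take_nil, List.take_of_length_le (h.length_prefix _).le,
      toCycle]
  exact htake ▸ h.isPrefixSystem_take j le_rfl

lemma prolong (h : IsPartialArrangement M n bs ps j) (hp : Prolongs ps ps' e)
    (he : ∀ a, e a ∈ rest (toCycle n bs) (toCycle n ps) a)
    (h' : IsPrefixSystem M (toCycle n bs) (extend (toCycle n ps) e)) :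
    IsPartialArrangement M n bs ps' (j + 1) where
  length_eq := hp.length_eq
  length_prefix m := by
    rw [hp.cyclicGet_eq, List.length_append, h.length_prefix, List.length_singleton]
  nodup_prefix m := by
    have hem := (mem_rest.1 (he m)).2
    rw [toCycle_natCast h.length_eq, List.mem_toFinset] at hem
    rw [hp.cyclicGet_eq]
    exact (h.nodup_prefix m).append (List.nodup_singleton _) (List.disjoint_singleton.2 hem)
  isPrefixSystem_take i hi := by
    rcases hi.lt_or_eq with hi | rfl
    · have htake : toCycle n (ps'.map (List.take i)) = toCycle n (ps.map (List.take i)) :=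
        funext fun m ↦ by
          rw [toCycle, cyclicGet_map List.take_nil, hp.cyclicGet_eq, List.take_append_of_le_length
            ((Nat.le_of_lt_succ hi).trans_eq (h.length_prefix _).symm), toCycle,
            cyclicGet_map List.take_nil]
      exact htake ▸ h.isPrefixSystem_take i (Nat.le_of_lt_succ hi)
    · have htake : toCycle n (ps'.map (List.take (j + 1))) = toCycle n ps' := funext fun m ↦ by
        rw [toCycle, cyclicGet_map List.take_nil, hp.cyclicGet_eq, List.take_of_length_le, toCycle,
          hp.cyclicGet_eq]
        rw [List.length_append, h.length_prefix, List.length_singleton]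
      rw [htake, hp.toCycle_eq]
      exact h'

lemma nonempty_rest (h : IsPartialArrangement M n bs ps j) (hb : IsBaseList M bs)
    (hbs : bs.length = n + 2) (hj : j < rk M) :
    (rest (toCycle n bs) (toCycle n ps) 0).Nonempty := by
  refine Finset.sdiff_nonempty.2 fun hsub ↦ hj.not_ge ?_
  have hcard := Finset.card_le_card hsub
  rwa [toCycle, toCycle, List.toFinset_card_of_nodup (hb.nodup_cyclicGet _),
    List.toFinset_card_of_nodup (h.nodup_prefix _), h.length_prefix,
    hb.length_eq_rk (cyclicGet_mem (hbs ▸ Nat.succ_ne_zero _) _)] at hcard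

lemma perm (h : IsPartialArrangement M n bs ps j) (hb : IsBaseList M bs)
    (hbs : bs.length = n + 2) (m : ℕ) :
    (cyclicGet ps m ++ restList bs ps m).Perm (cyclicGet bs m) :=
  perm_append_restList (hb.nodup_cyclicGet m) (h.nodup_prefix m) fun x hx ↦ by
    rw [← List.mem_toFinset, ← toCycle_natCast h.length_eq] at hx
    rw [← List.mem_toFinset, ← toCycle_natCast hbs]
    exact h.isPrefixSystem.subset _ hx

lemma isBase_drop_append_take (h : IsPartialArrangement M n bs ps j) (hb : IsBaseList M bs)
    (hbs : bs.length = n + 2) (m : ℕ) {i : ℕ} (hi : i ≤ j) :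
    M.IsBase {x | x ∈ (cyclicGet (arrange bs ps) m).drop i ++
      (cyclicGet (arrange bs ps) (m + 1)).take i} := by
  have hbase := (h.isPrefixSystem_take i hi).isBase_window m
  rw [window_toCycle hbs ((List.length_map _).trans h.length_eq), coe_toFinset_eq] at hbase
  have hlen := cyclicGet_arrange (h.length_eq.trans hbs.symm)
  rw [hlen, hlen, List.drop_append_of_le_length (hi.trans_eq (h.length_prefix m).symm),
    List.take_append_of_le_length (hi.trans_eq (h.length_prefix (m + 1)).symm)]
  convert hbase using 2
  ext x
  simp only [windowList, List.mem_append, mem_restList, cyclicGet_map List.take_nil]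
  have hmem : x ∈ cyclicGet ps m ↔ x ∈ (cyclicGet ps m).take i ∨ x ∈ (cyclicGet ps m).drop i := by
    rw [← List.mem_append, List.take_append_drop]
  have hdisj : x ∈ (cyclicGet ps m).take i → x ∉ (cyclicGet ps m).drop i := fun hx hx' ↦
    List.disjoint_take_drop (h.nodup_prefix m) le_rfl hx hx'
  have hsub : x ∈ cyclicGet ps m → x ∈ cyclicGet bs m := fun hx ↦
    (h.perm hb hbs m).subset (List.mem_append_left _ hx)
  rw [hmem] at hsub ⊢
  clear * - hdisj hsub
  tauto

lemma isCyclicOrdering (h : IsPartialArrangement M n bs ps (rk M)) (hb : IsBaseList M bs)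
    (hbs : bs.length = n + 2) : IsCyclicOrdering M (arrange bs ps).flatten :=
  (hb.arrange (h.length_eq.trans hbs.symm) (h.perm hb hbs)).isCyclicOrdering fun m _ hi ↦
    h.isBase_drop_append_take hb hbs m hi.le

end IsPartialArrangement

end Correctness

section Invariant

variable {α : Type*} {n j : ℕ} {ps : List (List α)}

lemma headI_filter_spec {β : Type*} [Inhabited β] {p : β → Prop} [DecidablePred p] {l : List β}
    (h : ∃ b ∈ l, p b) : (l.filter p).headI ∈ l ∧ p (l.filter p).headI := by
  have hmem : ∀ b, b ∈ l.filter p ↔ b ∈ l ∧ p b := fun b ↦ by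
    rw [List.mem_filter, decide_eq_true_eq]
  obtain ⟨b, hb⟩ := h
  obtain ⟨a, l', hl'⟩ := List.exists_cons_of_ne_nil (List.ne_nil_of_mem ((hmem b).2 hb))
  rw [← hmem, hl', List.headI_cons]
  exact List.mem_cons_self

lemma exists_prolongs (hps : ps.length = n + 2) (e : ZMod (n + 2) → α) :
    ∃ ps', Prolongs ps ps' e := by
  have hlen : ((List.range (n + 2)).map fun m ↦ cyclicGet ps m ++ [e m]).length = n + 2 := by
    rw [List.length_map, List.length_range]
  refine ⟨_, hlen, fun m ↦ ?_⟩
  have hmod := cyclicGet_mod ps m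
  rw [hps] at hmod
  rw [← cyclicGet_mod, hlen, cyclicGet_of_lt ((Nat.mod_lt _ n.succ.succ_pos).trans_eq hlen.symm),
    List.getElem_map, List.getElem_range, ZMod.natCast_mod, hmod]

variable [DecidableEq α] {T bs ps' ps'' : List (List α)} {cands : List (List (List α))}
  {M : Matroid α} {e : ZMod (n + 2) → α} {m : ZMod (n + 2)} {f : α}

lemma mem_variants : ps'' ∈ variants bs ps ps' ↔ ps'' = ps' ∨ ∃ m < bs.length,
    ∃ x ∈ restList bs ps m, ps'.set m (cyclicGet ps m ++ [x]) = ps'' := by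
  simp only [variants, prolongations, List.mem_cons, List.mem_flatMap, List.mem_range, List.mem_map,
    exists_exists_and_eq_and]

lemma mem_nextCands : ps'' ∈ nextCands T bs cands ↔
    ps'' ∈ variants bs (pick T bs cands) (advance T bs (pick T bs cands)) ∧
      KnownWindows T bs ps'' := by
  classical rw [nextCands, List.mem_filter, decide_eq_true_eq]

namespace Prolongs

lemma of_mem_variants (h : Prolongs ps ps' e) (hbs : bs.length = n + 2) (hps : ps.length = n + 2)
    (he : ∀ a, e a ∈ rest (toCycle n bs) (toCycle n ps) a) (h'' : ps'' ∈ variants bs ps ps') :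
    ∃ e' : ZMod (n + 2) → α, Prolongs ps ps'' e' ∧
      ∀ a, e' a ∈ rest (toCycle n bs) (toCycle n ps) a := by
  rcases mem_variants.1 h'' with rfl | ⟨m, hm, x, hx, rfl⟩
  · exact ⟨e, h, he⟩
  · rw [← List.mem_toFinset, ← rest_toCycle hbs hps] at hx
    exact ⟨_, h.set hps (hm.trans_eq hbs), IsPrefixSystem.update_mem_rest he hx⟩

lemma exists_mem_variants (h : Prolongs ps ps' e) (hbs : bs.length = n + 2)
    (hps : ps.length = n + 2) (hf : f ∈ rest (toCycle n bs) (toCycle n ps) m) :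
    ∃ ps'' ∈ variants bs ps ps', Prolongs ps ps'' (Function.update e m f) := by
  refine ⟨_, mem_variants.2 (Or.inr ⟨m.val, m.val_lt.trans_eq hbs.symm, f, ?_, rfl⟩), ?_⟩
  · rw [← List.mem_toFinset, ← rest_toCycle hbs hps, ZMod.natCast_zmod_val]
    exact hf
  · have hset := h.set (f := f) hps m.val_lt
    rwa [ZMod.natCast_zmod_val] at hset

end Prolongs

/-- The candidates are partial arrangements of length `j`, and one of them is unblocked. -/
structure IsCandidateList (M : Matroid α) (n : ℕ) (bs : List (List α))
    (cands : List (List (List α))) (j : ℕ) : Prop where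
  isPartialArrangement : ∀ ps ∈ cands, IsPartialArrangement M n bs ps j
  exists_isUnblocked : ∃ ps ∈ cands, IsUnblocked M (toCycle n bs) (toCycle n ps)

lemma Answers.componentQueries (h : Answers M (queries bs cands) T) :
    Answers M (componentQueries bs) T :=
  fun X hX ↦ h X (List.mem_append_left _ hX)

lemma Answers.exchangeQueries (h : Answers M (queries bs cands) T) (hps : ps ∈ cands) :
    Answers M (exchangeQueries bs ps) T :=
  fun X hX ↦ h X <| List.mem_append_right _ (List.mem_flatMap.2 ⟨ps, hps, hX⟩)

variable (hb : IsBaseList M bs) (hbs : bs.length = n + 2)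
include hb hbs

lemma IsCandidateList.pick_spec (h : IsCandidateList M n bs cands j)
    (hT : Answers M (queries bs cands) T) :
    pick T bs cands ∈ cands ∧ IsUnblocked M (toCycle n bs) (toCycle n (pick T bs cands)) := by
  classical
  have hiff : ∀ ps ∈ cands, KnownUnblocked T bs ps ↔ IsUnblocked M (toCycle n bs) (toCycle n ps) :=
    fun ps hps ↦ knownUnblocked_iff (h.isPartialArrangement ps hps).isPrefixSystem hbs
      (h.isPartialArrangement ps hps).length_eq (hT.exchangeQueries hps) hb hT.componentQueries
  obtain ⟨ps, hps, hu⟩ := h.exists_isUnblocked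
  have hpick := headI_filter_spec ⟨ps, hps, (hiff ps hps).2 hu⟩
  exact ⟨hpick.1, (hiff _ hpick.1).1 hpick.2⟩

variable (hM : ∀ x ∈ M.E, ∃ C : SplitSummand M, x ∈ C.ground)
include hM

lemma IsPartialArrangement.advance_spec (h : IsPartialArrangement M n bs ps j) (hj : j < rk M)
    (hu : IsUnblocked M (toCycle n bs) (toCycle n ps)) (hT : Answers M (exchangeQueries bs ps) T) :
    ∃ e, Prolongs ps (advance T bs ps) e ∧ (∀ a, e a ∈ rest (toCycle n bs) (toCycle n ps) a) ∧
      IsPrefixSystem M (toCycle n bs) (extend (toCycle n ps) e) := by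
  classical
  have hps := h.length_eq
  obtain ⟨e, he, h'⟩ := h.isPrefixSystem.exists_extend hM hu (h.nonempty_rest hb hbs hj)
  obtain ⟨ps', hp⟩ := exists_prolongs hps e
  have hadv := headI_filter_spec ⟨ps', hp.mem_sections hbs hps he,
    (hp.knownWindows_iff h.isPrefixSystem hbs hps hT he).2 h'⟩
  obtain ⟨e', hp', he'⟩ := Prolongs.of_mem_sections hbs hps hadv.1
  exact ⟨e', hp', he',
    (hp'.knownWindows_iff h.isPrefixSystem hbs hps hT he').1 hadv.2⟩

lemma IsCandidateList.nextCands (h : IsCandidateList M n bs cands j) (hj : j < rk M)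
    (hT : Answers M (queries bs cands) T) :
    IsCandidateList M n bs (nextCands T bs cands) (j + 1) := by
  obtain ⟨hpick, hu⟩ := h.pick_spec hb hbs hT
  have hTp := hT.exchangeQueries hpick
  have hA := h.isPartialArrangement _ hpick
  obtain ⟨e, hp, he, h'⟩ := hA.advance_spec hb hbs hM hj hu hTp
  have hmem : ∀ {ps'' e'}, ps'' ∈ variants bs (pick T bs cands) (advance T bs (pick T bs cands)) →
      Prolongs (pick T bs cands) ps'' e' →
      (∀ a, e' a ∈ rest (toCycle n bs) (toCycle n (pick T bs cands)) a) →
      (ps'' ∈ SplitMatroid.nextCands T bs cands ↔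
        IsPrefixSystem M (toCycle n bs) (extend (toCycle n (pick T bs cands)) e')) :=
    fun hv hp' he' ↦ by
      rw [mem_nextCands, and_iff_right hv]
      exact hp'.knownWindows_iff hA.isPrefixSystem hbs hA.length_eq hTp he'
  refine ⟨fun ps'' hps'' ↦ ?_, ?_⟩
  · have hv := (mem_nextCands.1 hps'').1
    obtain ⟨e', hp', he'⟩ := hp.of_mem_variants hbs hA.length_eq he hv
    exact hA.prolong hp' he' ((hmem hv hp' he').1 hps'')
  · rcases hA.isPrefixSystem.exists_isUnblocked_extend hM hu he h' with hu' | ⟨m, f, hf, h'', hu''⟩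
    · exact ⟨_, (hmem (mem_variants.2 (Or.inl rfl)) hp he).2 h', hp.toCycle_eq ▸ hu'⟩
    · obtain ⟨ps'', hv, hp''⟩ := hp.exists_mem_variants hbs hA.length_eq hf
      exact ⟨ps'', (hmem hv hp'' (IsPrefixSystem.update_mem_rest he hf)).2 h'',
        hp''.toCycle_eq ▸ hu''⟩

lemma isCandidateList_run {O : List α → Bool} (hO : ∀ X, O X = true ↔ M.Indep {x | x ∈ X})
    (hj : j ≤ rk M) : IsCandidateList M n bs (run O bs j) j := by
  induction j with
  | zero =>
    refine ⟨fun ps hps ↦ List.eq_of_mem_singleton hps ▸ hb.isPartialArrangement_nil hbs,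
      _, List.mem_singleton_self _, ?_⟩
    rw [toCycle_map_nil]
    exact (hb.isPrefixSystem_empty hbs).isUnblocked_empty hM
  | succ j ih =>
    refine (ih (Nat.le_of_succ_le hj)).nextCands hb hbs hM hj fun X hX ↦ ?_
    rw [List.mem_filter, and_iff_right hX, hO]

end Invariant

section Output

variable {α : Type*} {M : Matroid α} {bs : List (List α)}

lemma IsBaseList.isCyclicOrdering_of_length_le_one (hb : IsBaseList M bs) (h : bs.length ≤ 1) :
    IsCyclicOrdering M bs.flatten := by
  rcases Nat.le_one_iff_eq_zero_or_eq_one.1 h with h0 | h1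
  · rw [List.length_eq_zero_iff] at h0
    subst h0
    exact ⟨hb.nodup_flatten, Set.ext hb.mem_flatten, fun i hi ↦ absurd hi (Nat.not_lt_zero i)⟩
  · obtain ⟨l, rfl⟩ := List.length_eq_one_iff.1 h1
    refine hb.isCyclicOrdering fun m i _ ↦ ?_
    have hget : ∀ m, cyclicGet [l] m = l := fun m ↦
      List.mem_singleton.1 (cyclicGet_mem one_ne_zero m)
    rw [hget, hget]
    convert hb.isBase l (List.mem_singleton_self l) using 2
    ext x
    rw [← List.perm_append_comm.mem_iff, List.take_append_drop]

variable [DecidableEq α] {O : List α → Bool}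

/-- The number of stages of the algorithm. -/
def numStages (bs : List (List α)) : ℕ := if bs.length ≤ 1 then 0 else (cyclicGet bs 0).length

/-- The rearranged blocks that the algorithm computes with the oracle `O`. -/
noncomputable def outputBlocks (O : List α → Bool) (bs : List (List α)) : List (List α) :=
  arrange bs (run O bs (numStages bs)).headI

lemma outputBlocks_of_length_le_one (h : bs.length ≤ 1) : outputBlocks O bs = bs := by
  rw [outputBlocks, numStages, if_pos h]
  exact arrange_map_nil

variable (hb : IsBaseList M bs) (hM : ∀ x ∈ M.E, ∃ C : SplitSummand M, x ∈ C.ground)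
  (hO : ∀ X, O X = true ↔ M.Indep {x | x ∈ X})
include hb hM hO

lemma isPartialArrangement_headI_run {n : ℕ} (hbs : bs.length = n + 2) :
    IsPartialArrangement M n bs (run O bs (numStages bs)).headI (rk M) := by
  have hstages : numStages bs = rk M := by
    rw [numStages, if_neg (by omega), hb.length_eq_rk (cyclicGet_mem (by omega) 0)]
  have hrun := isCandidateList_run hb hbs hM hO (j := rk M) le_rfl
  obtain ⟨ps, hps, -⟩ := hrun.exists_isUnblocked
  obtain ⟨c, l, hl⟩ := List.exists_cons_of_ne_nil (List.ne_nil_of_mem hps)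
  rw [hstages, hl, List.headI_cons]
  exact hrun.isPartialArrangement c (hl ▸ List.mem_cons_self)

lemma outputBlocks_spec : IsCyclicOrdering M (outputBlocks O bs).flatten ∧
    IsBaseList M (outputBlocks O bs) ∧ (outputBlocks O bs).length = bs.length ∧
      ∀ m, (cyclicGet (outputBlocks O bs) m).Perm (cyclicGet bs m) := by
  rcases le_or_gt bs.length 1 with h | h
  · rw [outputBlocks_of_length_le_one h]
    exact ⟨hb.isCyclicOrdering_of_length_le_one h, hb, rfl, fun m ↦ .refl _⟩
  · obtain ⟨n, hn⟩ := Nat.exists_eq_add_of_le' h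
    have hps := isPartialArrangement_headI_run hb hM hO hn
    have hlen := hps.length_eq.trans hn.symm
    refine ⟨hps.isCyclicOrdering hb hn, hb.arrange hlen (hps.perm hb hn), length_arrange,
      fun m ↦ ?_⟩
    rw [outputBlocks, cyclicGet_arrange hlen]
    exact hps.perm hb hn m

theorem blocksInOrder_outputBlocks {k : ℕ} {b : Fin k → List α} (hbs : bs = List.ofFn b) :
    BlocksInOrder M (fun i ↦ {x | x ∈ b i}) (outputBlocks O bs).flatten := by
  obtain ⟨-, hbl, hlen, hperm⟩ := outputBlocks_spec hb hM hO
  refine hbl.blocksInOrder (hlen.trans (by rw [hbs, List.length_ofFn])) fun i ↦ ?_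
  rw [← cyclicGet_ofFn (b := b) i, ← hbs]
  exact hperm i

end Output

/-! ### Oracle calls -/

section Batches

variable {ι σ : Type*}

/-- Those of the queries `qs` whose answer, according to the list of answers `a`, is positive. -/
def positives (qs : List ι) (a : List Bool) : List ι :=
  ((qs.zip a).filter Prod.snd).map Prod.fst

lemma positives_map_append (O : ι → Bool) (qs : List ι) (a : List Bool) :
    positives qs (qs.map O ++ a) = qs.filter O := by
  induction qs with
  | nil => rfl
  | cons q qs ih =>
    rw [positives, List.map_cons, List.cons_append, List.zip_cons_cons, List.filter_cons,
      List.filter_cons, apply_ite (List.map Prod.fst), List.map_cons, ← positives, ih]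

variable (Q : σ → List ι) (f : List ι → σ → σ)

/-- One stage of a computation with states in `σ` that asks an oracle the queries `Q s` and passes
from `s` to `f T s`, where `T` is the list of the queries answered positively. The state comes with
the oracle's answers that have not been used yet. If they do not suffice for the stage, then the
result is the next query. -/
def stageStep : ι ⊕ σ × List Bool → ι ⊕ σ × List Bool
  | .inl q => .inl q
  | .inr (s, a) =>
    match (Q s)[a.length]? with
    | some q => .inl q
    | none => .inr (f (positives (Q s) a) s, a.drop (Q s).length)

/-- The queries in the first `n` stages that start in the state `s`, when `O` is the oracle. -/
def stageQueries (O : ι → Bool) : ℕ → σ → List ι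
  | 0, _ => []
  | n + 1, s => Q s ++ stageQueries O n (f ((Q s).filter O) s)

variable {Q f} {O : ι → Bool}

lemma stageStep_map_append {s : σ} {a : List Bool} :
    stageStep Q f (.inr (s, (Q s).map O ++ a)) = .inr (f ((Q s).filter O) s, a) := by
  have h : (Q s)[((Q s).map O ++ a).length]? = none := by
    rw [List.getElem?_eq_none_iff, List.length_append, List.length_map]
    exact Nat.le_add_right _ _
  rw [stageStep, h, positives_map_append, List.drop_left' (List.length_map O)]

lemma stageStep_map_of_eq_append {s : σ} {l l' : List ι} {q : ι} (h : Q s = l ++ q :: l') :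
    stageStep Q f (.inr (s, l.map O)) = .inl q := by
  have hq : (Q s)[(l.map O).length]? = some q := by
    rw [h, List.length_map, List.getElem?_append_right le_rfl, Nat.sub_self,
      List.getElem?_cons_zero]
  rw [stageStep, hq]

lemma stageStep_iterate_map_stageQueries (n : ℕ) (s : σ) :
    (stageStep Q f)^[n] (.inr (s, (stageQueries Q f O n s).map O)) =
      .inr ((fun s ↦ f ((Q s).filter O) s)^[n] s, []) := by
  induction n generalizing s with
  | zero => rfl
  | succ n ih =>
    rw [Function.iterate_succ_apply, stageQueries, List.map_append, stageStep_map_append, ih,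
      Function.iterate_succ_apply]

lemma stageStep_iterate_of_stageQueries_eq_append {n : ℕ} {s : σ} {l l' : List ι} {q : ι}
    (h : stageQueries Q f O n s = l ++ q :: l') :
    (stageStep Q f)^[n] (.inr (s, l.map O)) = .inl q := by
  induction n generalizing s l with
  | zero => exact absurd h (by simp [stageQueries])
  | succ n ih =>
    rw [Function.iterate_succ_apply]
    obtain ⟨l₁, rfl, hl₁⟩ | ⟨l₁, hQ, hl₁⟩ := List.append_eq_append_iff.1 h
    · rw [List.map_append, stageStep_map_append, ih hl₁]
    · cases l₁ with
      | nil =>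
        rw [List.append_nil] at hQ
        rw [← List.append_nil (l.map O), ← hQ, stageStep_map_append]
        exact ih (l := []) hl₁.symm
      | cons q' l₁ =>
        obtain ⟨rfl, -⟩ := List.cons.inj hl₁
        rw [stageStep_map_of_eq_append hQ]
        exact Function.iterate_fixed rfl n

lemma length_stageQueries_le {p : σ → Prop} {c : ℕ} (hf : ∀ T s, p s → p (f T s))
    (hQ : ∀ s, p s → (Q s).length ≤ c) {n : ℕ} {s : σ} (hs : p s) :
    (stageQueries Q f O n s).length ≤ n * c := by
  induction n generalizing s with
  | zero => exact Nat.zero_le _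
  | succ n ih =>
    rw [stageQueries, List.length_append, Nat.add_one_mul, Nat.add_comm]
    exact Nat.add_le_add (ih (hf _ s hs)) (hQ s hs)

end Batches

section Procedure

variable {M : Matroid ℕ} {O : List ℕ → Bool} {bs : List (List ℕ)}

lemma haltsWith_of_forall_eq_append {P : OracleProcedure} {qs : List (List ℕ)} {s : List ℕ}
    (hO : ∀ X, O X = true ↔ M.Indep {x | x ∈ X})
    (hask : ∀ l X l', qs = l ++ X :: l' → P bs (l.map O) = .inl X)
    (hhalt : P bs (qs.map O) = .inr s) : HaltsWith P M bs s qs.length := by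
  suffices h : ∀ l l', qs = l ++ l' → Reaches P M bs (l.map O) from
    ⟨qs.map O, h qs [] (List.append_nil qs).symm, hhalt, List.length_map O⟩
  intro l
  induction l using List.reverseRecOn with
  | nil => exact fun _ _ ↦ .start
  | append_singleton l X ih =>
    intro l' hl'
    rw [List.append_assoc] at hl'
    rw [List.map_append]
    exact .call (ih _ hl') (hask l X l' hl') (hO X)

/-- The algorithm as an oracle procedure. -/
noncomputable def procedure : OracleProcedure := fun bs a ↦
  match (stageStep (queries bs) fun T ↦ nextCands T bs)^[numStages bs]
      (.inr ([bs.map fun _ ↦ []], a)) with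
  | .inl X => .inl X
  | .inr (cands, _) => .inr (arrange bs cands.headI).flatten

/-- All oracle calls of the algorithm, in their order, when `O` is the oracle. -/
noncomputable def oracleCalls (O : List ℕ → Bool) (bs : List (List ℕ)) : List (List ℕ) :=
  stageQueries (queries bs) (fun T ↦ nextCands T bs) O (numStages bs) [bs.map fun _ ↦ []]

lemma run_eq_iterate {α : Type*} [DecidableEq α] {O : List α → Bool} {bs : List (List α)} (j : ℕ) :
    run O bs j = (fun cands ↦ nextCands ((queries bs cands).filter O) bs cands)^[j]
      [bs.map fun _ ↦ []] := by
  induction j with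
  | zero => rfl
  | succ j ih => rw [run, ih, Function.iterate_succ_apply']

theorem haltsWith_procedure (hO : ∀ X, O X = true ↔ M.Indep {x | x ∈ X}) :
    HaltsWith procedure M bs (outputBlocks O bs).flatten (oracleCalls O bs).length := by
  refine haltsWith_of_forall_eq_append hO (fun l X l' h ↦ ?_) ?_
  · rw [procedure, stageStep_iterate_of_stageQueries_eq_append h]
  · rw [procedure, oracleCalls, stageStep_iterate_map_stageQueries, ← run_eq_iterate, outputBlocks]

end Procedure

section Cost

variable {α : Type*}

lemma length_flatMap_le {β γ : Type*} {l : List β} {f : β → List γ} {c : ℕ}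
    (h : ∀ x ∈ l, (f x).length ≤ c) : (l.flatMap f).length ≤ l.length * c := by
  rw [List.length_flatMap, ← List.length_map (fun x ↦ (f x).length)]
  exact List.sum_le_card_nsmul _ c (List.forall_mem_map.2 h)

lemma sum_length_cyclicGet (bs : List (List α)) :
    ((List.range bs.length).map fun m ↦ (cyclicGet bs m).length).sum = bs.flatten.length := by
  rw [List.length_flatten]
  congr 1
  refine List.ext_getElem (by simp) fun i h _ ↦ ?_
  rw [List.length_map, List.length_range] at h
  rw [List.getElem_map, List.getElem_map, List.getElem_range, cyclicGet_of_lt h]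

lemma length_cyclicGet_le (bs : List (List α)) (m : ℕ) :
    (cyclicGet bs m).length ≤ bs.flatten.length := by
  rcases eq_or_ne bs.length 0 with h | h
  · rw [List.length_eq_zero_iff.1 h, cyclicGet_nil]
    exact le_rfl
  · exact (List.sublist_flatten_of_mem (cyclicGet_mem h m)).length_le

lemma length_flatMap_range_le {γ : Type*} {bs : List (List α)} {f : ℕ → List γ} {c : ℕ}
    (h : ∀ m, (f m).length ≤ (cyclicGet bs m).length * c) :
    ((List.range bs.length).flatMap f).length ≤ bs.flatten.length * c := by
  rw [List.length_flatMap, ← sum_length_cyclicGet, ← List.sum_map_mul_right]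
  exact List.sum_le_sum fun m _ ↦ h m

lemma numStages_le (bs : List (List α)) : numStages bs ≤ bs.flatten.length := by
  rw [numStages]
  split
  · exact Nat.zero_le _
  · exact length_cyclicGet_le bs 0

variable [DecidableEq α] {T bs ps : List (List α)} {cands : List (List (List α))} {m : ℕ}

lemma length_restList_le : (restList bs ps m).length ≤ (cyclicGet bs m).length :=
  List.length_filter_le _ _

lemma length_componentQueries_le :
    (componentQueries bs).length ≤ bs.flatten.length * bs.flatten.length :=
  (length_flatMap_le fun _ _ ↦ List.length_map _ |>.le).trans
    (Nat.mul_le_mul_right _ (length_cyclicGet_le bs 0))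

lemma length_exchangeQueries_le :
    (exchangeQueries bs ps).length ≤ bs.flatten.length * bs.flatten.length := by
  refine length_flatMap_range_le fun m ↦ ?_
  refine (length_flatMap_le fun x _ ↦ ?_).trans (Nat.mul_le_mul_right _ length_restList_le)
  rw [List.length_map]
  exact length_restList_le.trans (length_cyclicGet_le bs (m + 1))

lemma length_nextCands_le : (nextCands T bs cands).length ≤ bs.flatten.length + 1 := by
  refine (List.length_filter_le _ _).trans (Nat.succ_le_succ ?_)
  refine (length_flatMap_range_le (c := 1) fun m ↦ ?_).trans_eq (mul_one _)
  rw [List.length_map, prolongations, List.length_map, mul_one]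
  exact length_restList_le

lemma length_queries_le (h : cands.length ≤ bs.flatten.length + 1) :
    (queries bs cands).length ≤ bs.flatten.length * bs.flatten.length +
      (bs.flatten.length + 1) * (bs.flatten.length * bs.flatten.length) := by
  rw [queries, List.length_append]
  exact Nat.add_le_add length_componentQueries_le
    ((length_flatMap_le fun _ _ ↦ length_exchangeQueries_le).trans (Nat.mul_le_mul_right _ h))

open Polynomial in
/-- A bound for the number of oracle calls in terms of the size `X` of the ground set: there are at
most `X` stages with `X * X` queries about components and `X + 1` candidates that take `X * X`
queries each. -/
noncomputable def costBound : ℕ[X] := X * (X * X + (X + 1) * (X * X))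

lemma length_oracleCalls_le (O : List ℕ → Bool) (bs : List (List ℕ)) :
    (oracleCalls O bs).length ≤ costBound.eval bs.flatten.length := by
  simp only [costBound, Polynomial.eval_mul, Polynomial.eval_add, Polynomial.eval_X,
    Polynomial.eval_one]
  refine (length_stageQueries_le (p := fun cands ↦ cands.length ≤ bs.flatten.length + 1)
    (fun _ _ _ ↦ length_nextCands_le) (fun _ h ↦ length_queries_le h)
    (Nat.le_add_left _ _)).trans (Nat.mul_le_mul_right _ (numStages_le bs))

end Cost

/-! ### Computability -/

section Primrec

open _root_.Primrec

variable {α β σ : Type*} [Primcodable α] [Primcodable β] [Primcodable σ]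

lemma primrecPred_exists_mem {f : β → List σ} {p : β → σ → Prop} (hf : Primrec f)
    (hp : PrimrecPred fun q : β × σ ↦ p q.1 q.2) : PrimrecPred fun b ↦ ∃ a ∈ f b, p b a :=
  (PrimrecRel.exists_mem_list (R := fun a b ↦ p b a)
    (PrimrecPred.comp hp (pair snd fst))).comp hf .id

lemma primrecPred_forall_mem {f : β → List σ} {p : β → σ → Prop} (hf : Primrec f)
    (hp : PrimrecPred fun q : β × σ ↦ p q.1 q.2) : PrimrecPred fun b ↦ ∀ a ∈ f b, p b a :=
  (PrimrecRel.forall_mem_list (R := fun a b ↦ p b a)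
    (PrimrecPred.comp hp (pair snd fst))).comp hf .id

lemma primrecPred_forall_lt {f : β → ℕ} {p : β → ℕ → Prop} (hf : Primrec f)
    (hp : PrimrecPred fun q : β × ℕ ↦ p q.1 q.2) : PrimrecPred fun b ↦ ∀ a < f b, p b a :=
  (primrecPred_forall_mem (list_range.comp hf) hp).of_eq fun b ↦ by simp only [List.mem_range]

lemma primrec_filter {f : β → List σ} {p : β → σ → Prop} [∀ b a, Decidable (p b a)]
    (hf : Primrec f) (hp : PrimrecPred fun q : β × σ ↦ p q.1 q.2) :
    Primrec fun b ↦ (f b).filter fun a ↦ decide (p b a) :=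
  (PrimrecRel.listFilter (R := fun a b ↦ p b a)
    (PrimrecPred.comp hp (pair snd fst))).comp hf .id

lemma primrecPred_mem {f : β → σ} {l : β → List σ} (hf : Primrec f) (hl : Primrec l) :
    PrimrecPred fun b ↦ f b ∈ l b :=
  (primrecPred_exists_mem (p := fun b a ↦ a = f b) hl
    (Primrec.eq.comp snd (hf.comp fst))).of_eq fun _ ↦ exists_eq_right

lemma primrec_sections : Primrec (List.sections : List (List σ) → List (List σ)) := by
  have h : Primrec fun L : List (List σ) ↦ L.foldr
      (fun l s ↦ s.flatMap fun t ↦ l.map fun a ↦ a :: t) [[]] :=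
    list_foldr (h := fun (_ : List (List σ)) (q : List σ × List (List σ)) ↦
        q.2.flatMap fun t ↦ q.1.map fun a ↦ a :: t) .id (.const _) <|
      list_flatMap (snd.comp snd) <| list_map (fst.comp (snd.comp fst)) <|
        list_cons.comp snd (snd.comp fst)
  refine h.of_eq fun L ↦ ?_
  induction L with
  | nil => rfl
  | cons l L ih => rw [List.foldr_cons, ih, List.sections]

lemma primrec_zip [Inhabited α] [Inhabited σ] :
    Primrec fun q : List α × List σ ↦ q.1.zip q.2 := by
  have h : Primrec fun q : List α × List σ ↦ (List.range (min q.1.length q.2.length)).map fun i ↦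
      (q.1.getD i default, q.2.getD i default) :=
    list_map (list_range.comp (nat_min.comp (list_length.comp fst) (list_length.comp snd))) <|
      pair ((list_getD default).comp (fst.comp fst) snd)
        ((list_getD default).comp (snd.comp fst) snd)
  refine h.of_eq fun q ↦ List.ext_getElem (by simp) fun i hi hi' ↦ ?_
  rw [List.length_zip, lt_min_iff] at hi'
  rw [List.getElem_map, List.getElem_range, List.getElem_zip, List.getD_eq_getElem _ _ hi'.1,
    List.getD_eq_getElem _ _ hi'.2]

section Relations

variable {R : β → α → α → Prop} {B S Q Q' : β → List α} {x y c : β → α}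
  (hR : PrimrecPred fun q : β × α × α ↦ R q.1 q.2.1 q.2.2)
include hR

lemma primrecPred_arrow (hB : Primrec B) (hx : Primrec x) (hy : Primrec y) :
    PrimrecPred fun b ↦ Arrow (R b) {z | z ∈ B b} (x b) (y b) :=
  (Primrec.eq.comp hx hy).or ((primrecPred_mem hx hB).and
    ((primrecPred_mem hy hB).not.and (PrimrecPred.comp hR (pair .id (pair hx hy)))))

lemma primrecPred_linked (hB : Primrec B) (hS : Primrec S) (hx : Primrec x) (hy : Primrec y) :
    PrimrecPred fun b ↦ Linked (R b) {z | z ∈ B b} {z | z ∈ S b} (x b) (y b) := by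
  have hR' : PrimrecPred fun q : (β × α) × α × α ↦ R q.1.1 q.2.1 q.2.2 :=
    PrimrecPred.comp hR (pair (fst.comp fst) snd)
  exact primrecPred_exists_mem hS
    ((primrecPred_arrow hR' (hB.comp fst) (hx.comp fst) snd).and
      (primrecPred_arrow hR' (hB.comp fst) (hy.comp fst) snd))

lemma primrecPred_mem_component (hB : Primrec B) (hS : Primrec S) (hc : Primrec c)
    (hy : Primrec y) :
    PrimrecPred fun b ↦ y b ∈ component (R b) {z | z ∈ B b} {z | z ∈ S b} (c b) := by
  have hR' : PrimrecPred fun q : (β × α) × α × α ↦ R q.1.1 q.2.1 q.2.2 :=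
    PrimrecPred.comp hR (pair (fst.comp fst) snd)
  exact primrecPred_exists_mem hB
    ((primrecPred_linked hR' (hB.comp fst) (hS.comp fst) (hc.comp fst) snd).and
      (primrecPred_linked hR' (hB.comp fst) (hS.comp fst) snd (hy.comp fst)))

lemma primrecPred_splitAt (hQ : Primrec Q) (hQ' : Primrec Q') :
    PrimrecPred fun b ↦ SplitAt (R b) {z | z ∈ Q b} {z | z ∈ Q' b} := by
  have hr {γ : Type _} [Primcodable γ] {g : γ → β} {v w : γ → α} (hg : Primrec g)
      (hv : Primrec v) (hw : Primrec w) : PrimrecPred fun e ↦ R (g e) (v e) (w e) :=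
    PrimrecPred.comp hR (pair hg (pair hv hw))
  refine primrecPred_exists_mem hQ (primrecPred_exists_mem (hQ.comp fst)
    (primrecPred_exists_mem (hQ'.comp (fst.comp fst))
      (primrecPred_exists_mem (hQ'.comp (fst.comp (fst.comp fst))) ?_)))
  have hb : Primrec fun q : (((β × α) × α) × α) × α ↦ q.1.1.1.1 :=
    fst.comp (fst.comp (fst.comp fst))
  have hz₀ : Primrec fun q : (((β × α) × α) × α) × α ↦ q.1.1.1.2 :=
    snd.comp (fst.comp (fst.comp fst))
  have hz₁ : Primrec fun q : (((β × α) × α) × α) × α ↦ q.1.1.2 := snd.comp (fst.comp fst)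
  have hy₀ : Primrec fun q : (((β × α) × α) × α) × α ↦ q.1.2 := snd.comp fst
  have hy₁ : Primrec fun q : (((β × α) × α) × α) × α ↦ q.2 := snd
  refine (hr hb hz₀ hy₀).not.and ((hr hb hz₁ hy₁).not.and ((hr hb hz₀ hy₁).and
    ((primrecPred_forall_mem (hQ.comp hb) ?_).and (primrecPred_forall_mem (hQ'.comp hb) ?_))))
  · exact (hr (hb.comp fst) snd (hy₀.comp fst)).not.or (hr (hb.comp fst) snd (hy₁.comp fst)).not
  · exact (hr (hb.comp fst) (hz₀.comp fst) snd).not.or (hr (hb.comp fst) (hz₁.comp fst) snd).not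

end Relations

variable {ls bs ps ps' T : β → List (List α)} {x y c : β → α} {m : β → ℕ}
  {cands : β → List (List (List α))}

lemma primrec_cyclicGet (hls : Primrec ls) (hm : Primrec m) :
    Primrec fun b ↦ cyclicGet (ls b) (m b) :=
  (list_getD []).comp hls (nat_mod.comp hm (list_length.comp hls))

lemma primrec_numStages : Primrec (numStages (α := α)) :=
  .ite (nat_le.comp list_length (.const 1)) (.const 0)
    (list_length.comp (primrec_cyclicGet .id (.const 0)))

variable [DecidableEq α]

lemma primrec_restList (hbs : Primrec bs) (hps : Primrec ps) (hm : Primrec m) :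
    Primrec fun b ↦ restList (bs b) (ps b) (m b) :=
  primrec_filter (primrec_cyclicGet hbs hm)
    (primrecPred_mem snd (primrec_cyclicGet (hps.comp fst) (hm.comp fst))).not

lemma primrec_windowList (hbs : Primrec bs) (hps : Primrec ps) (hm : Primrec m) :
    Primrec fun b ↦ windowList (bs b) (ps b) (m b) :=
  list_append.comp (primrec_restList hbs hps hm) (primrec_cyclicGet hps (succ.comp hm))

lemma primrec_exchangeList (hbs : Primrec bs) (hps : Primrec ps) (hm : Primrec m)
    (hx : Primrec x) (hy : Primrec y) :
    Primrec fun b ↦ exchangeList (bs b) (ps b) (m b) (x b) (y b) :=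
  list_append.comp
    (primrec_filter (p := fun b z ↦ z ≠ x b) (primrec_restList hbs hps hm)
      (Primrec.eq.comp snd (hx.comp fst)).not)
    (list_concat.comp (primrec_cyclicGet hps (succ.comp hm)) hy)

lemma primrec_arrange (hbs : Primrec bs) (hps : Primrec ps) :
    Primrec fun b ↦ arrange (bs b) (ps b) :=
  list_map (list_range.comp (list_length.comp hbs)) <|
    list_append.comp (primrec_cyclicGet (hps.comp fst) snd)
      (primrec_restList (hbs.comp fst) (hps.comp fst) snd)

lemma primrecPred_knownWindows (hT : Primrec T) (hbs : Primrec bs) (hps : Primrec ps) :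
    PrimrecPred fun b ↦ KnownWindows (T b) (bs b) (ps b) :=
  primrecPred_forall_lt (list_length.comp hbs) <|
    primrecPred_mem (primrec_windowList (hbs.comp fst) (hps.comp fst) snd) (hT.comp fst)

lemma primrecPred_exchangeList_mem (hT : Primrec T) (hbs : Primrec bs) (hps : Primrec ps)
    (hm : Primrec m) :
    PrimrecPred fun q : β × α × α ↦
      exchangeList (bs q.1) (ps q.1) (m q.1) q.2.1 q.2.2 ∈ T q.1 :=
  primrecPred_mem (primrec_exchangeList (hbs.comp fst) (hps.comp fst) (hm.comp fst)
    (fst.comp snd) (snd.comp snd)) (hT.comp fst)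

lemma primrecPred_mem_knownComponent (hT : Primrec T) (hbs : Primrec bs) (hc : Primrec c)
    (hy : Primrec y) : PrimrecPred fun b ↦ y b ∈ knownComponent (T b) (bs b) (c b) :=
  primrecPred_mem_component (primrecPred_exchangeList_mem hT hbs (.const []) (.const 0))
    (primrec_cyclicGet hbs (.const 0)) (list_flatten.comp hbs) hc hy

lemma primrecPred_knownBlocked {A : β → Set α} (hT : Primrec T) (hbs : Primrec bs)
    (hps : Primrec ps) (hA : PrimrecPred fun q : β × α ↦ q.2 ∈ A q.1) :
    PrimrecPred fun b ↦ KnownBlocked (T b) (bs b) (ps b) (A b) := by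
  classical
  have hrest {m : β × ℕ → ℕ} (hm : Primrec m) : Primrec fun q : β × ℕ ↦
      (restList (bs q.1) (ps q.1) (m q)).filter fun x ↦ x ∈ A q.1 :=
    primrec_filter (primrec_restList (hbs.comp fst) (hps.comp fst) hm)
      (PrimrecPred.comp hA (pair (fst.comp fst) snd))
  refine primrecPred_forall_lt (list_length.comp hbs) <| (primrecPred_splitAt
    (R := fun q x y ↦ exchangeList (bs q.1) (ps q.1) q.2 x y ∈ T q.1)
    (primrecPred_exchangeList_mem (hT.comp fst) (hbs.comp fst) (hps.comp fst) snd)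
    (hrest snd) (hrest (succ.comp snd))).of_eq fun q ↦ ?_
  simp only [List.mem_filter, decide_eq_true_eq]

lemma primrecPred_knownUnblocked (hT : Primrec T) (hbs : Primrec bs) (hps : Primrec ps) :
    PrimrecPred fun b ↦ KnownUnblocked (T b) (bs b) (ps b) :=
  primrecPred_forall_mem (primrec_cyclicGet hbs (.const 0)) <|
    (primrecPred_knownBlocked (hT.comp fst) (hbs.comp fst) (hps.comp fst) <|
      primrecPred_mem_knownComponent (hT.comp (fst.comp fst)) (hbs.comp (fst.comp fst))
        (snd.comp fst) snd).not

lemma primrec_componentQueries : Primrec (componentQueries (α := α)) :=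
  list_flatMap (primrec_cyclicGet .id (.const 0)) <| list_map (list_flatten.comp fst) <|
    primrec_exchangeList (fst.comp fst) (.const []) (.const 0) (snd.comp fst) snd

lemma primrec_exchangeQueries (hbs : Primrec bs) (hps : Primrec ps) :
    Primrec fun b ↦ exchangeQueries (bs b) (ps b) := by
  refine list_flatMap (list_range.comp (list_length.comp hbs)) <|
    list_flatMap (primrec_restList (hbs.comp fst) (hps.comp fst) snd) <|
      list_map (primrec_restList (hbs.comp (fst.comp fst)) (hps.comp (fst.comp fst))
        (succ.comp (snd.comp fst))) ?_
  have hb : Primrec fun q : ((β × ℕ) × α) × α ↦ q.1.1.1 := fst.comp (fst.comp fst)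
  exact primrec_exchangeList (hbs.comp hb) (hps.comp hb) (snd.comp (fst.comp fst)) (snd.comp fst)
    snd

lemma primrec_queries (hbs : Primrec bs) (hcands : Primrec cands) :
    Primrec fun b ↦ queries (bs b) (cands b) :=
  list_append.comp (primrec_componentQueries.comp hbs) <|
    list_flatMap hcands (primrec_exchangeQueries (hbs.comp fst) snd)

lemma primrec_prolongations (hbs : Primrec bs) (hps : Primrec ps) (hm : Primrec m) :
    Primrec fun b ↦ prolongations (bs b) (ps b) (m b) :=
  list_map (primrec_restList hbs hps hm) <|
    list_concat.comp (primrec_cyclicGet (hps.comp fst) (hm.comp fst)) snd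

lemma primrec_pick (hT : Primrec T) (hbs : Primrec bs) (hcands : Primrec cands) :
    Primrec fun b ↦ pick (T b) (bs b) (cands b) := by
  classical
  exact list_headI.comp (primrec_filter hcands
    (primrecPred_knownUnblocked (hT.comp fst) (hbs.comp fst) snd))

lemma primrec_advance (hT : Primrec T) (hbs : Primrec bs) (hps : Primrec ps) :
    Primrec fun b ↦ advance (T b) (bs b) (ps b) := by
  classical
  refine list_headI.comp (primrec_filter (primrec_sections.comp ?_)
    (primrecPred_knownWindows (hT.comp fst) (hbs.comp fst) snd))
  exact list_map (list_range.comp (list_length.comp hbs))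
    (primrec_prolongations (hbs.comp fst) (hps.comp fst) snd)

lemma primrec_variants (hbs : Primrec bs) (hps : Primrec ps) (hps' : Primrec ps') :
    Primrec fun b ↦ variants (bs b) (ps b) (ps' b) :=
  list_cons.comp hps' <| list_flatMap (list_range.comp (list_length.comp hbs)) <|
    list_map (primrec_prolongations (hbs.comp fst) (hps.comp fst) snd) <|
      list_set.comp (hps'.comp (fst.comp fst)) (pair (snd.comp fst) snd)

lemma primrec_nextCands (hT : Primrec T) (hbs : Primrec bs) (hcands : Primrec cands) :
    Primrec fun b ↦ nextCands (T b) (bs b) (cands b) := by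
  classical
  have hpick := primrec_pick hT hbs hcands
  exact primrec_filter (primrec_variants hbs hpick (primrec_advance hT hbs hpick))
    (primrecPred_knownWindows (hT.comp fst) (hbs.comp fst) snd)

end Primrec

section ComputableProcedure

open _root_.Primrec

lemma primrec_positives {ι : Type*} [Primcodable ι] [Inhabited ι] :
    Primrec₂ (positives (ι := ι)) :=
  (list_map ((listFilter (p := fun q : ι × Bool ↦ q.2 = true)
    (Primrec.eq.comp snd (.const true))).comp primrec_zip) (fst.comp snd).to₂).of_eq fun q ↦ by
      simp only [positives, Bool.decide_eq_true]

lemma primrec_stageStep {β ι σ : Type*} [Primcodable β] [Primcodable ι] [Inhabited ι]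
    [Primcodable σ] {Q : β → σ → List ι} {f : β → List ι → σ → σ} (hQ : Primrec₂ Q)
    (hf : Primrec fun q : β × List ι × σ ↦ f q.1 q.2.1 q.2.2) :
    Primrec₂ fun b ↦ stageStep (Q b) (f b) := by
  have hQs : Primrec fun q : (β × (ι ⊕ σ × List Bool)) × σ × List Bool ↦ Q q.1.1 q.2.1 :=
    hQ.comp (fst.comp fst) (fst.comp snd)
  have ha : Primrec fun q : (β × (ι ⊕ σ × List Bool)) × σ × List Bool ↦ q.2.2 := snd.comp snd
  have hnext : Primrec fun q : (β × (ι ⊕ σ × List Bool)) × σ × List Bool ↦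
      (.inr (f q.1.1 (positives (Q q.1.1 q.2.1) q.2.2) q.2.1, q.2.2.drop (Q q.1.1 q.2.1).length) :
        ι ⊕ σ × List Bool) :=
    sumInr.comp (pair (hf.comp (pair (fst.comp fst) (pair (primrec_positives.comp hQs ha)
      (fst.comp snd)))) (list_drop.comp (list_length.comp hQs) ha))
  refine (sumCasesOn snd (sumInl.comp snd).to₂ (option_casesOn (list_getElem?.comp hQs
    (list_length.comp ha)) hnext (sumInl.comp snd).to₂).to₂).of_eq ?_
  rintro ⟨b, q | ⟨s, a⟩⟩
  · rfl
  · dsimp only [stageStep]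
    cases (Q b s)[a.length]? <;> rfl

theorem primrec_procedure : Primrec₂ procedure := by
  have hinit : Primrec fun q : List (List ℕ) × List Bool ↦
      (.inr ([q.1.map fun _ ↦ []], q.2) : List ℕ ⊕ List (List (List ℕ)) × List Bool) :=
    sumInr.comp (pair (list_cons.comp (list_map fst (.const [])) (.const [])) snd)
  have hstep : Primrec₂ fun q : List (List ℕ) × List Bool ↦
      stageStep (queries q.1) fun T ↦ nextCands T q.1 :=
    primrec_stageStep (primrec_queries (fst.comp fst) snd)
      (primrec_nextCands (fst.comp snd) (fst.comp fst) (snd.comp snd))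
  refine (sumCasesOn (nat_iterate (primrec_numStages.comp fst) hinit hstep)
    (sumInl.comp snd).to₂ (sumInr.comp (list_flatten.comp
      (primrec_arrange (fst.comp fst) (list_headI.comp (fst.comp snd))))).to₂).of_eq ?_
  rintro ⟨bs, a⟩
  rw [procedure]
  split <;> simp_all

end ComputableProcedure

/-! ### Direct sums and the oracle -/

section DirectSum

variable {α : Type*}

/-- Direct sums of finitely many elementary split matroids. -/
def IsElementarySplitSum (M : Matroid α) : Prop :=
  ∃ (t : ℕ) (N : Fin t → Matroid α) (h : Pairwise (Disjoint on fun i ↦ (N i).E)),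
    (∀ i, IsElementarySplit (N i)) ∧ M = Matroid.disjointSigma N h

lemma IsUniform.isElementarySplit {M : Matroid α} (h : IsUniform M) : IsElementarySplit M := by
  obtain ⟨hfin, r, hbase⟩ := h
  obtain ⟨X, hX⟩ := M.exists_isBase
  obtain ⟨hXE, rfl⟩ := (hbase X).1 hX
  exact ⟨hfin, X.ncard, 0, Fin.elim0, Fin.elim0, Set.ncard_le_ncard hXE hfin, fun i ↦ i.elim0,
    fun i ↦ i.elim0, fun i ↦ i.elim0, fun Y ↦ by rw [hbase, and_iff_left fun i ↦ i.elim0]⟩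

lemma IsSplit.isElementarySplitSum {M : Matroid α} (h : IsSplit M) : IsElementarySplitSum M := by
  obtain ⟨t, N, hN, h₀, hs, rfl⟩ := h
  exact ⟨t + 1, N, hN, Fin.cases h₀ fun i ↦ (hs i).isElementarySplit, rfl⟩

lemma IsElementarySplitSum.finite_ground {M : Matroid α} (h : IsElementarySplitSum M) :
    M.E.Finite := by
  obtain ⟨t, N, hN, hs, rfl⟩ := h
  rw [Matroid.disjointSigma_ground_eq]
  exact Set.finite_iUnion fun i ↦ (hs i).1

variable [DecidableEq α]

lemma isBase_disjointSigma_exchange {ι : Type*} {N : ι → Matroid α}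
    {h : Pairwise (Disjoint on fun i ↦ (N i).E)} {W : Finset α} {x y : α} {i : ι}
    (hW : (Matroid.disjointSigma N h).IsBase (W : Set α)) (hx : x ∈ (N i).E) (hy : y ∈ (N i).E)
    (hi : (N i).IsBase (exchange W x y ∩ (N i).E)) :
    (Matroid.disjointSigma N h).IsBase (exchange W x y : Set α) := by
  rw [Matroid.disjointSigma_isBase_iff] at hW ⊢
  refine ⟨fun j ↦ ?_, fun z hz ↦ ?_⟩
  · rcases eq_or_ne j i with rfl | hj
    · exact hi
    have hxj : x ∉ (N j).E := fun h' ↦ Set.disjoint_left.1 (h hj) h' hx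
    have hyj : y ∉ (N j).E := fun h' ↦ Set.disjoint_left.1 (h hj) h' hy
    convert hW.1 j using 1
    ext z
    simp only [Set.mem_inter_iff, Finset.mem_coe, mem_exchange]
    grind
  · rcases mem_exchange.1 hz with rfl | ⟨-, hz⟩
    · exact Set.mem_iUnion.2 ⟨i, hy⟩
    · exact hW.2 hz

lemma exists_splitSummand {ι : Type*} {N : ι → Matroid α}
    (h : Pairwise (Disjoint on fun i ↦ (N i).E)) {i : ι} (hi : IsElementarySplit (N i)) :
    ∃ C : SplitSummand (Matroid.disjointSigma N h), (C.ground : Set α) = (N i).E := by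
  obtain ⟨hfin, r, q, H, ρ, -, hH, hinter, -, hbase⟩ := hi
  lift H to Fin q → Finset α using fun j ↦ hfin.subset (hH j)
  obtain ⟨E, hE⟩ := hfin.exists_finset_coe
  have hHE (j) : H j ⊆ E := Finset.coe_subset.1 (hE.symm ▸ hH j)
  have hbase' (W : Finset α) : (N i).IsBase (W ∩ (N i).E) ↔
      (W ∩ E).card = r ∧ ∀ j, (W ∩ H j).card ≤ ρ j := by
    have hWH (j) : W ∩ E ∩ H j = W ∩ H j := by
      rw [Finset.inter_assoc, Finset.inter_eq_right.2 (hHE j)]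
    rw [hbase, ← hE, ← Finset.coe_inter, Set.ncard_coe_finset]
    simp only [← Finset.coe_inter, Set.ncard_coe_finset, hWH]
    exact and_iff_right (Finset.coe_subset.2 Finset.inter_subset_right)
  have hbaseM {W : Finset α} (hW : (Matroid.disjointSigma N h).IsBase (W : Set α)) :
      (W ∩ E).card = r ∧ ∀ j, (W ∩ H j).card ≤ ρ j :=
    (hbase' W).1 ((Matroid.disjointSigma_isBase_iff.1 hW).1 i)
  refine ⟨{ ground := E, rank := r, Index := Fin q, H := H, ρ := ρ
            ground_subset := ?_
            H_subset := hHE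
            card_inter_add_rank_le := fun a b hab ↦ ?_
            card_inter_ground := fun hW ↦ (hbaseM hW).1
            card_inter_H_le := fun hW ↦ (hbaseM hW).2
            exchanges := fun {W x y} hW hx hy hxE hyE hle ↦ ?_ }, hE⟩
  · rw [hE, Matroid.disjointSigma_ground_eq]
    exact Set.subset_iUnion (fun i ↦ (N i).E) i
  · rw [← Set.ncard_coe_finset, Finset.coe_inter]
    exact hinter a b hab
  · have hcard := card_exchange_inter hx hy E
    rw [if_pos hxE, if_pos hyE, (hbaseM hW).1] at hcard
    exact isBase_disjointSigma_exchange hW (hE ▸ hxE) (hE ▸ hyE)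
      ((hbase' _).2 ⟨Nat.add_right_cancel hcard, hle⟩)

lemma IsElementarySplitSum.exists_mem_ground {M : Matroid α} (h : IsElementarySplitSum M) {x : α}
    (hx : x ∈ M.E) : ∃ C : SplitSummand M, x ∈ C.ground := by
  obtain ⟨t, N, hN, hs, rfl⟩ := h
  rw [Matroid.disjointSigma_ground_eq, Set.mem_iUnion] at hx
  obtain ⟨i, hi⟩ := hx
  obtain ⟨C, hC⟩ := exists_splitSummand hN (hs i)
  exact ⟨C, Finset.mem_coe.1 (hC ▸ hi)⟩

end DirectSum

section Oracle

variable {α : Type*}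

open scoped Classical in
/-- The independence oracle of `M`, for sets given by lists. -/
noncomputable def indepOracle (M : Matroid α) (X : List α) : Bool :=
  decide (M.Indep {x | x ∈ X})

lemma indepOracle_eq_true {M : Matroid α} {X : List α} :
    indepOracle M X = true ↔ M.Indep {x | x ∈ X} := by
  classical exact decide_eq_true_iff

variable [DecidableEq α] {M : Matroid α} {k : ℕ} {b : Fin k → List α}

lemma IsElementarySplitSum.outputBlocks_spec (hM : IsElementarySplitSum M) (hnd : ∀ i, (b i).Nodup)
    (hb : IsBasePartition M fun i ↦ {x | x ∈ b i}) :
    IsCyclicOrdering M (outputBlocks (indepOracle M) (List.ofFn b)).flatten ∧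
      BlocksInOrder M (fun i ↦ {x | x ∈ b i})
        (outputBlocks (indepOracle M) (List.ofFn b)).flatten :=
  have hbs := hb.isBaseList hnd
  have hC (x) (hx : x ∈ M.E) := hM.exists_mem_ground hx
  ⟨(SplitMatroid.outputBlocks_spec hbs hC fun _ ↦ indepOracle_eq_true).1,
    blocksInOrder_outputBlocks hbs hC (fun _ ↦ indepOracle_eq_true) rfl⟩

end Oracle

lemma IsBasePartition.exists_lists {α : Type*} {M : Matroid α} {k : ℕ} {B : Fin k → Set α}
    (hE : M.E.Finite) (hB : IsBasePartition M B) :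
    ∃ b : Fin k → List α, (∀ i, (b i).Nodup) ∧ (fun i ↦ {x | x ∈ b i}) = B := by
  have h (i) : ∃ l : List α, l.Nodup ∧ {x | x ∈ l} = B i :=
    have hfin : (B i).Finite := hE.subset (hB.1 i).subset_ground
    ⟨hfin.toFinset.toList, Finset.nodup_toList _, by simp⟩
  choose b hnd hb using h
  exact ⟨b, hnd, funext hb⟩

end SplitMatroid

theorem theorem1_general :
    (∀ {α : Type*} (M : Matroid α), SplitMatroid.IsElementarySplitSum M →
      ∀ (k : ℕ) (B : Fin k → Set α), SplitMatroid.IsBasePartition M B →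
        ∃ s : List α, SplitMatroid.IsCyclicOrdering M s ∧ SplitMatroid.BlocksInOrder M B s) ∧
    ∃ (P : SplitMatroid.OracleProcedure) (p : Polynomial ℕ), Computable₂ P ∧
      ∀ M : Matroid ℕ, SplitMatroid.IsElementarySplitSum M →
        ∀ (k : ℕ) (b : Fin k → List ℕ), (∀ i, (b i).Nodup) →
          SplitMatroid.IsBasePartition M (fun i ↦ {x | x ∈ b i}) →
            ∃ (s : List ℕ) (c : ℕ),
              SplitMatroid.HaltsWith P M (List.ofFn b) s c ∧
              c ≤ p.eval M.E.ncard ∧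
              SplitMatroid.IsCyclicOrdering M s ∧
              SplitMatroid.BlocksInOrder M (fun i ↦ {x | x ∈ b i}) s := by
  refine ⟨fun M hM k B hB ↦ ?_, SplitMatroid.procedure, SplitMatroid.costBound,
    SplitMatroid.primrec_procedure.to_comp, fun M hM k b hnd hb ↦ ?_⟩
  · classical
    obtain ⟨b, hnd, rfl⟩ := hB.exists_lists hM.finite_ground
    exact ⟨_, hM.outputBlocks_spec hnd hB⟩
  · refine ⟨_, _, SplitMatroid.haltsWith_procedure fun _ ↦ SplitMatroid.indepOracle_eq_true, ?_,
      hM.outputBlocks_spec hnd hb⟩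
    rw [(hb.isBaseList hnd).ncard_ground]
    exact SplitMatroid.length_oracleCalls_le _ _

theorem theorem1 :
    (∀ {α : Type*} (M : Matroid α), SplitMatroid.IsSplit M →
      ∀ (k : ℕ) (B : Fin k → Set α), SplitMatroid.IsBasePartition M B →
        ∃ s : List α, SplitMatroid.IsCyclicOrdering M s ∧ SplitMatroid.BlocksInOrder M B s) ∧
    ∃ (P : SplitMatroid.OracleProcedure) (p : Polynomial ℕ), Computable₂ P ∧
      ∀ M : Matroid ℕ, SplitMatroid.IsSplit M →
        ∀ (k : ℕ) (b : Fin k → List ℕ), (∀ i, (b i).Nodup) →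
          SplitMatroid.IsBasePartition M (fun i ↦ {x | x ∈ b i}) →
            ∃ (s : List ℕ) (c : ℕ),
              SplitMatroid.HaltsWith P M (List.ofFn b) s c ∧
              c ≤ p.eval M.E.ncard ∧
              SplitMatroid.IsCyclicOrdering M s ∧
              SplitMatroid.BlocksInOrder M (fun i ↦ {x | x ∈ b i}) s :=
  have ⟨h, P, p, hP, hPp⟩ := theorem1_general
  ⟨fun M hM ↦ h M hM.isElementarySplitSum, P, p, hP,
    fun M hM ↦ hPp M hM.isElementarySplitSum⟩
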